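/- Let $\mathbb K$ be an algebraically closed field of characteristic zero, let $N$ be a lattice (a free abelian group of finite rank), $M=\mathrm{Hom}(N,\mathbb Z)$ the dual lattice with pairing $\langle\cdot,\cdot\rangle\colon M\times N\to\mathbb Z$, and let $\sigma\subset N_{\mathbb Q}=N\otimes_{\mathbb Z}\mathbb Q$ be a pointed (i.e. containing no line) rational polyhedral cone. Let $X$ be the corresponding affine normal toric variety, with algebra of regular functions $$B=\mathbb K[X]=\bigoplus_{m\in\sigma^\vee\cap M}\mathbb K\chi^m .$$ A locally nilpotent derivation (LND) of $B$ is a $\mathbb K$-linear derivation $\delta\colon B\to B$ such that for every $f\in B$ there is $n$ with $\delta^n(f)=0$. Two LNDs are equivalent if their kernels coincide. An LND $\delta$ is called maximal if every nonzero LND of $B$ commuting with $\delta$ is equivalent to $\delta$. Let $\rho$ be an extremal ray (one-dimensional face) of $\sigma$ and let $v\in N$ be the primitive lattice vector on $\rho$. A Demazure root of $\sigma$ corresponding to $\rho$ is a vector $e\in M$ such that $\langle e,v\rangle=-1$ and $\langle e,v'\rangle\ge 0$ for the primitive lattice vector $v'$ on every extremal ray $\rho'\ne\rho$ of $\sigma$.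 Such an $e$ defines the LND $\delta_e$ of $B$ by $$\delta_e(\chi^m)=\langle m,v\rangle\,\chi^{m+e},\qquad m\in\sigma^\vee\cap M .$$ Let $\mathcal E(\rho)$ be the set of extremal rays $\rho'\neq\rho$ of $\sigma$ that lie together with $\rho$ in a common two-dimensional face of $\sigma$. **Proposition.** Let $e$ be a Demazure root corresponding to an extremal ray $\rho$ of $\sigma$. Then the LND $\delta_e$ is maximal if and only if $\langle e,v'\rangle\neq 0$ for every extremal ray $\rho'\in\mathcal E(\rho)$, where $v'$ denotes the primitive lattice vector on $\rho'$. -/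

import Mathlib

open scoped TensorProduct

noncomputable section

namespace AffineToric

/-! ### Lattices, cones and their faces

`N` is a lattice (a finitely generated free abelian group), the lattice of one-parameter subgroups
of a torus; `M = Hom(N, ℤ)` is the character lattice, and `N_ℚ = ℚ ⊗ N`. -/

section Lattice

variable {N : Type*} [AddCommGroup N]

/-- The lattice `M = Hom(N, ℤ)`; the pairing `⟨m, v⟩` of `m : M` and `v : N` is `m v`. -/
abbrev CharLattice (N : Type*) [AddCommGroup N] : Type _ := Module.Dual ℤ N

/-- The rational vector space `N_ℚ = ℚ ⊗ N`. -/
abbrev RatSpace (N : Type*) [AddCommGroup N] : Type _ := ℚ ⊗[ℤ] N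

/-- The natural map `N → N_ℚ`. -/
def toRat (v : N) : RatSpace N := (1 : ℚ) ⊗ₜ[ℤ] v

/-- The pairing `⟨m, ·⟩ : N_ℚ → ℚ`, the `ℚ`-linear extension of `m : N → ℤ`. -/
def ratPairing (m : CharLattice N) : RatSpace N →ₗ[ℚ] ℚ :=
  Module.Dual.baseChange ℚ m

/-- A vector of `N` is primitive if it is not a proper multiple of another lattice vector
(in particular it is not zero). -/
def IsPrimitive (v : N) : Prop := ∀ (k : ℤ) (w : N), v = k • w → IsUnit k

/-- The dimension of a cone: the dimension of its linear span. -/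
def coneDim (F : PointedCone ℚ (RatSpace N)) : ℕ :=
  Module.finrank ℚ (Submodule.span ℚ (F : Set (RatSpace N)))

/-- An extremal ray of `σ`: a one-dimensional face. -/
def IsExtremalRay (σ ρ : PointedCone ℚ (RatSpace N)) : Prop :=
  ρ.IsFaceOf σ ∧ coneDim ρ = 1

/-- `v` is a primitive lattice vector on the ray `ρ`. -/
def IsPrimitiveVectorOf (ρ : PointedCone ℚ (RatSpace N)) (v : N) : Prop :=
  IsPrimitive v ∧ toRat v ∈ ρ

/-- The set `ℰ(ρ)` of the extremal rays of `σ`, different from `ρ`, that lie with `ρ` in a common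
two-dimensional face of `σ`. -/
def adjacentRays (σ ρ : PointedCone ℚ (RatSpace N)) : Set (PointedCone ℚ (RatSpace N)) :=
  {ρ' | IsExtremalRay σ ρ' ∧ ρ' ≠ ρ ∧
    ∃ F : PointedCone ℚ (RatSpace N), F.IsFaceOf σ ∧ coneDim F = 2 ∧ ρ ≤ F ∧ ρ' ≤ F}

/-- A Demazure root of `σ` corresponding to the extremal ray `ρ`: it pairs to `-1` with the
primitive vector on `ρ` and nonnegatively with the primitive vectors on the other extremal rays. -/
structure IsDemazureRoot (σ ρ : PointedCone ℚ (RatSpace N)) (e : CharLattice N) : Prop where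
  pairing_self : ∀ v, IsPrimitiveVectorOf ρ v → e v = -1
  pairing_nonneg : ∀ ρ', IsExtremalRay σ ρ' → ρ' ≠ ρ → ∀ v', IsPrimitiveVectorOf ρ' v' → 0 ≤ e v'

/-- The semigroup `σ^∨ ∩ M`. -/
def dualSemigroup (σ : PointedCone ℚ (RatSpace N)) : AddSubmonoid (CharLattice N) where
  carrier := {m | ∀ x ∈ σ, 0 ≤ ratPairing m x}
  zero_mem' := by intro x _; simp [ratPairing]
  add_mem' := by
    intro a b ha hb x hx
    have := add_nonneg (ha x hx) (hb x hx)
    simpa [ratPairing] using this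

@[simp] theorem ratPairing_toRat (m : CharLattice N) (v : N) :
    ratPairing m (toRat v) = (m v : ℚ) := by
  simp [ratPairing, toRat]

/-- Every element of `N_ℚ` has a positive integer multiple in `N`. -/
theorem exists_smul_eq_toRat (x : RatSpace N) : ∃ d : ℕ, 0 < d ∧ ∃ w : N, (d : ℚ) • x = toRat w := by
  induction x using TensorProduct.induction_on with
  | zero => exact ⟨1, one_pos, 0, by simp [toRat]⟩
  | tmul q n =>
    refine ⟨q.den, q.den_pos, q.num • n, ?_⟩
    rw [toRat, TensorProduct.tmul_smul, TensorProduct.smul_tmul', TensorProduct.smul_tmul']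
    congr 1
    simp
  | add x y hx hy =>
    obtain ⟨a, ha, u, hu⟩ := hx
    obtain ⟨b, hb, w, hw⟩ := hy
    refine ⟨a * b, Nat.mul_pos ha hb, (b : ℤ) • u + (a : ℤ) • w, ?_⟩
    have h1 : toRat ((b : ℤ) • u + (a : ℤ) • w) = (b : ℚ) • toRat u + (a : ℚ) • toRat w := by
      simp [toRat, TensorProduct.tmul_add, TensorProduct.smul_tmul']
    rw [h1, ← hu, ← hw, smul_add, smul_smul, smul_smul]
    push_cast
    rw [mul_comm (b : ℚ) a]

/-- Every nonzero lattice vector is a positive multiple of a primitive one. -/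
theorem exists_primitive [Module.Free ℤ N] (w : N) (hw : w ≠ 0) :
    ∃ (k : ℕ) (v : N), 0 < k ∧ IsPrimitive v ∧ w = (k : ℤ) • v := by
  obtain ⟨f, hf⟩ : ∃ f : Module.Dual ℤ N, f w ≠ 0 := by
    by_contra! h
    exact hw ((Module.forall_dual_apply_eq_zero_iff ℤ w).1 h)
  have key : ∀ (n : ℕ) (w : N), f w ≠ 0 → (f w).natAbs ≤ n →
      ∃ (k : ℤ) (v : N), k ≠ 0 ∧ IsPrimitive v ∧ w = k • v := by
    intro n
    induction n with
    | zero => intro w h1 h2; omega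
    | succ n ih =>
      intro w h1 h2
      by_cases hp : IsPrimitive w
      · exact ⟨1, w, one_ne_zero, hp, by simp⟩
      · simp only [IsPrimitive, not_forall] at hp
        obtain ⟨k, u, rfl, hk⟩ := hp
        rw [map_smul, smul_eq_mul] at h1 h2
        have hk0 : k ≠ 0 := left_ne_zero_of_mul h1
        have hu0 : f u ≠ 0 := right_ne_zero_of_mul h1
        have hk1 : k.natAbs ≠ 1 := fun h => hk (Int.isUnit_iff_natAbs_eq.2 h)
        have hk2 : 2 ≤ k.natAbs := by omega
        rw [Int.natAbs_mul] at h2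
        have : 2 * (f u).natAbs ≤ n + 1 := le_trans (Nat.mul_le_mul_right _ hk2) h2
        obtain ⟨l, v, hl, hv, rfl⟩ := ih u hu0 (by omega)
        exact ⟨k * l, v, mul_ne_zero hk0 hl, hv, by rw [mul_smul]⟩
  obtain ⟨k, v, hk, hv, h⟩ := key _ w hf le_rfl
  rcases lt_or_gt_of_ne hk with hneg | hpos
  · refine ⟨k.natAbs, -v, by omega, ?_, ?_⟩
    · intro l u hu
      exact hv l (-u) (by rw [smul_neg, ← hu, neg_neg])
    · rw [h, smul_neg, ← neg_smul]
      congr 1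
      omega
  · exact ⟨k.natAbs, v, by omega, hv, by rw [h]; congr 1; omega⟩

/-- A pointed rational polyhedral cone is generated by the primitive vectors on its extremal
rays. -/
theorem eq_hull_primitive [Module.Free ℤ N] (σ : PointedCone ℚ (RatSpace N)) (hfg : σ.FG)
    (hσ : σ.toConvexCone.Salient) :
    σ ≤ PointedCone.hull ℚ
      {x | ∃ ρ v, IsExtremalRay σ ρ ∧ IsPrimitiveVectorOf ρ v ∧ x = toRat v} := by
  classical
  have hex : ∃ n : ℕ, ∃ G : Finset (RatSpace N),
      PointedCone.hull ℚ (G : Set (RatSpace N)) = σ ∧ G.card = n := by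
    obtain ⟨G, hG⟩ := hfg
    exact ⟨_, G, hG, rfl⟩
  obtain ⟨G, hG, hcard⟩ := Nat.find_spec hex
  have hmin : ∀ G' : Finset (RatSpace N), PointedCone.hull ℚ (G' : Set (RatSpace N)) = σ →
      G.card ≤ G'.card := fun G' h => hcard ▸ Nat.find_min' hex ⟨G', h, rfl⟩
  suffices h : ∀ g ∈ G, g ∈ PointedCone.hull ℚ
      {x | ∃ ρ v, IsExtremalRay σ ρ ∧ IsPrimitiveVectorOf ρ v ∧ x = toRat v} by
    conv_lhs => rw [← hG]
    exact Submodule.span_le.2 h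
  intro g hg
  have hgσ : g ∈ σ := hG ▸ Submodule.subset_span hg
  set C := PointedCone.hull ℚ ((G.erase g : Finset (RatSpace N)) : Set (RatSpace N)) with hC
  have hsup : σ = PointedCone.hull ℚ {g} ⊔ C := by
    rw [hC, ← hG, PointedCone.hull, ← Submodule.span_union, Finset.coe_erase,
      Set.singleton_union, Set.insert_sdiff_singleton, Set.insert_eq_of_mem hg]
  have hCσ : C ≤ σ := hsup ▸ le_sup_right
  have hgC : g ∉ C := by
    intro h
    have h1 : C = σ := by
      rw [hsup]
      refine le_antisymm le_sup_right (sup_le (Submodule.span_le.2 ?_) le_rfl)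
      simpa using h
    have := hmin _ h1
    have := Finset.card_erase_lt_of_mem hg
    omega
  have hg0 : g ≠ 0 := fun h => hgC (h ▸ C.zero_mem)
  have hmem : ∀ x ∈ σ, ∃ a : ℚ, 0 ≤ a ∧ ∃ y ∈ C, x = a • g + y := by
    intro x hx
    rw [hsup] at hx
    obtain ⟨z, hz, y, hy, rfl⟩ := Submodule.mem_sup.1 hx
    obtain ⟨a, rfl⟩ := Submodule.mem_span_singleton.1 hz
    exact ⟨a, a.2, y, hy, rfl⟩
  have hmul : ∀ a : ℚ, 0 ≤ a → a • g ∈ PointedCone.hull ℚ {g} := fun a ha =>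
    PointedCone.smul_mem _ ha (Submodule.subset_span rfl)
  have hface : (PointedCone.hull ℚ {g}).IsFaceOf σ := by
    refine PointedCone.IsFaceOf.of_mem_of_add_mem_left (hsup ▸ le_sup_left) ?_
    intro x y hx hy hxy
    obtain ⟨a, ha, x', hx', rfl⟩ := hmem x hx
    obtain ⟨b, hb, y', hy', rfl⟩ := hmem y hy
    obtain ⟨c, hc⟩ := Submodule.mem_span_singleton.1 hxy
    have hc' : (c : ℚ) • g = a • g + x' + (b • g + y') := hc
    have heq : (c - a - b : ℚ) • g = x' + y' := by
      rw [sub_smul, sub_smul, hc']; abel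
    rcases lt_or_ge 0 (c - a - b : ℚ) with hpos | hneg
    · exfalso
      apply hgC
      have : g = (c - a - b : ℚ)⁻¹ • (x' + y') := by
        rw [← heq, smul_smul, inv_mul_cancel₀ hpos.ne', one_smul]
      rw [this]
      exact PointedCone.smul_mem _ (inv_nonneg.2 hpos.le) (C.add_mem hx' hy')
    · have hx0 : x' = 0 := by
        by_contra hne
        refine hσ x' (hCσ hx') hne ?_
        have : -x' = y' + (-(c - a - b) : ℚ) • g := by
          rw [neg_smul, heq]; abel
        rw [this]
        exact σ.add_mem (hCσ hy') (PointedCone.smul_mem _ (by linarith) hgσ)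
      rw [hx0, add_zero]
      exact hmul a ha
  have hray : IsExtremalRay σ (PointedCone.hull ℚ {g}) := by
    refine ⟨hface, ?_⟩
    rw [coneDim, Submodule.span_span_of_tower, finrank_span_singleton hg0]
  obtain ⟨d, hd, w, hdw⟩ := exists_smul_eq_toRat g
  have hdQ : (0 : ℚ) < d := by exact_mod_cast hd
  have hw0 : w ≠ 0 := by
    rintro rfl
    rw [toRat, TensorProduct.tmul_zero] at hdw
    exact (smul_ne_zero hdQ.ne' hg0) hdw
  obtain ⟨k, v, hk, hv, rfl⟩ := exists_primitive w hw0
  have hkQ : (0 : ℚ) < k := by exact_mod_cast hk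
  have hkv : toRat ((k : ℤ) • v) = (k : ℚ) • toRat v := by
    simp [toRat, TensorProduct.smul_tmul']
  rw [hkv] at hdw
  have h1 : toRat v = ((k : ℚ)⁻¹ * d) • g := by
    rw [mul_smul, hdw, smul_smul, inv_mul_cancel₀ hkQ.ne', one_smul]
  have h2 : g = ((d : ℚ)⁻¹ * k) • toRat v := by
    rw [mul_smul, ← hdw, smul_smul, inv_mul_cancel₀ hdQ.ne', one_smul]
  have hvρ : IsPrimitiveVectorOf (PointedCone.hull ℚ {g}) v :=
    ⟨hv, by rw [h1]; exact hmul _ (by positivity)⟩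
  rw [h2]
  exact PointedCone.smul_mem _ (by positivity) (Submodule.subset_span ⟨_, v, hray, hvρ, rfl⟩)

/-- Membership in `σ^∨ ∩ M` is decided by the primitive vectors on the extremal rays of `σ`. -/
theorem mem_dualSemigroup_of_primitive [Module.Free ℤ N] (σ : PointedCone ℚ (RatSpace N))
    (hfg : σ.FG) (hσ : σ.toConvexCone.Salient) (m : CharLattice N)
    (h : ∀ ρ v, IsExtremalRay σ ρ → IsPrimitiveVectorOf ρ v → 0 ≤ m v) :
    m ∈ dualSemigroup σ := by
  have hle : σ ≤ (PointedCone.positive ℚ ℚ).comap (ratPairing m) := by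
    refine (eq_hull_primitive σ hfg hσ).trans (Submodule.span_le.2 ?_)
    rintro _ ⟨ρ, v, hρ, hv, rfl⟩
    simpa using h ρ v hρ hv
  intro x hx
  simpa using hle hx

theorem apply_nonneg_of_mem_dualSemigroup {σ ρ : PointedCone ℚ (RatSpace N)} {m : CharLattice N}
    {v : N} (hm : m ∈ dualSemigroup σ) (hρ : IsExtremalRay σ ρ) (hv : IsPrimitiveVectorOf ρ v) :
    0 ≤ m v := by
  have := hm _ (hρ.1.le hv.2)
  rw [ratPairing_toRat] at this
  exact_mod_cast this

/-- If `e` is a Demazure root for the ray of `v`, then `m + e` stays in `σ^∨ ∩ M` for every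
`m ∈ σ^∨ ∩ M` with `⟨m, v⟩ ≠ 0`. -/
theorem IsDemazureRoot.add_mem [Module.Free ℤ N] {σ ρ : PointedCone ℚ (RatSpace N)}
    (hfg : σ.FG) (hσ : σ.toConvexCone.Salient) (hρ : IsExtremalRay σ ρ) {v : N}
    (hv : IsPrimitiveVectorOf ρ v) {e : CharLattice N} (he : IsDemazureRoot σ ρ e)
    {m : CharLattice N} (hm : m ∈ dualSemigroup σ) (hmv : m v ≠ 0) :
    m + e ∈ dualSemigroup σ := by
  refine mem_dualSemigroup_of_primitive σ hfg hσ _ ?_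
  intro ρ' v' hρ' hv'
  have h0 := apply_nonneg_of_mem_dualSemigroup hm hρ' hv'
  rw [LinearMap.add_apply]
  by_cases h : ρ' = ρ
  · subst h
    have h1 := he.pairing_self v' hv'
    have h2 : m v' ≠ 0 := by
      intro h3
      have hne : toRat v' ≠ 0 := by
        intro h4
        have := ratPairing_toRat e v'
        rw [h4, h1] at this
        simp at this
      obtain ⟨c, hc⟩ := exists_smul_eq_of_finrank_eq_one hρ.2
        (x := ⟨toRat v', Submodule.subset_span hv'.2⟩) (by simpa [Subtype.ext_iff] using hne)
        ⟨toRat v, Submodule.subset_span hv.2⟩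
      have hc' : c • toRat v' = toRat v := congrArg Subtype.val hc
      have := ratPairing_toRat m v
      rw [← hc', map_smul, ratPairing_toRat, h3] at this
      simp at this
      exact hmv (by exact_mod_cast this.symm)
    omega
  · have := he.pairing_nonneg ρ' hρ' h v' hv'
    omega

end Lattice

/-! ### The coordinate ring of an affine normal toric variety and its derivations -/

section Derivations

variable (K : Type*) [Field K] {N : Type*} [AddCommGroup N]

/-- The group algebra `K[M] = ⨁_{m ∈ M} K χ^m`, the algebra of regular functions on the torus. -/
abbrev TorusRing (N : Type*) [AddCommGroup N] : Type _ := AddMonoidAlgebra K (CharLattice N)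

variable {K} in
/-- The character `χ^m`. -/
def character (m : CharLattice N) : TorusRing K N := AddMonoidAlgebra.single m 1

/-- The algebra `K[X] = ⨁_{m ∈ σ^∨ ∩ M} K χ^m` of regular functions on the affine normal toric
variety `X` of the cone `σ`, as a subalgebra of `K[M]`. -/
def coordinateRing (σ : PointedCone ℚ (RatSpace N)) : Subalgebra K (TorusRing K N) where
  carrier := {f | ∀ m ∈ f.coeff.support, m ∈ dualSemigroup σ}
  mul_mem' := by
    classical
    intro f g hf hg m hm
    obtain ⟨a, ha, b, hb, rfl⟩ := Finset.mem_add.1 (AddMonoidAlgebra.support_coeff_mul_subset f g hm)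
    exact (dualSemigroup σ).add_mem (hf a ha) (hg b hb)
  add_mem' := by
    classical
    intro f g hf hg m hm
    rcases Finset.mem_union.1 (Finsupp.support_add hm) with h | h
    · exact hf m h
    · exact hg m h
  algebraMap_mem' := by
    intro r m hm
    rw [AddMonoidAlgebra.coe_algebraMap] at hm
    obtain rfl := Finset.mem_singleton.1 (Finsupp.support_single_subset hm)
    exact (dualSemigroup σ).zero_mem

theorem single_mem_coordinateRing {σ : PointedCone ℚ (RatSpace N)} {m : CharLattice N}
    (hm : m ∈ dualSemigroup σ) (r : K) : AddMonoidAlgebra.single m r ∈ coordinateRing K σ := by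
  intro k hk
  obtain rfl := Finset.mem_singleton.1 (Finsupp.support_single_subset hk)
  exact hm

/-- The `K`-linear map `χ^m ↦ ⟨m, v⟩ χ^{m+e}` of `K[M]`. -/
def torusDerivationAux (v : N) (e : CharLattice N) : TorusRing K N →ₗ[K] TorusRing K N :=
  (Finsupp.lsum K fun m : CharLattice N =>
      ((m v : ℤ) : K) • LinearMap.toSpanSingleton K (TorusRing K N) (character (m + e))) ∘ₗ
    (AddMonoidAlgebra.coeffLinearEquiv K).toLinearMap

theorem torusDerivationAux_single (v : N) (e m : CharLattice N) (r : K) :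
    torusDerivationAux K v e (AddMonoidAlgebra.single m r) =
      AddMonoidAlgebra.single (m + e) (((m v : ℤ) : K) * r) := by
  simp [torusDerivationAux, character]

/-- The derivation `χ^m ↦ ⟨m, v⟩ χ^{m+e}` of `K[M]`. -/
def torusDerivation (v : N) (e : CharLattice N) :
    Derivation K (TorusRing K N) (TorusRing K N) :=
  Derivation.mk' (torusDerivationAux K v e) <| by
    intro a b
    induction a using AddMonoidAlgebra.induction_linear with
    | zero => simp
    | add f g hf hg => simp only [add_mul, map_add, hf, hg, smul_eq_mul, mul_add]; ring
    | single m r =>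
      induction b using AddMonoidAlgebra.induction_linear with
      | zero => simp
      | add f g hf hg => simp only [mul_add, map_add, hf, hg, smul_eq_mul, add_mul]; ring
      | single k s =>
        simp only [AddMonoidAlgebra.single_mul_single, torusDerivationAux_single, smul_eq_mul]
        rw [show m + (k + e) = m + k + e by abel, show k + (m + e) = m + k + e by abel,
          ← AddMonoidAlgebra.single_add]
        congr 1
        push_cast [LinearMap.add_apply]
        ring

@[simp] theorem torusDerivation_character (v : N) (e m : CharLattice N) :
    torusDerivation K v e (character m) = ((m v : ℤ) : K) • character (m + e) := by
  simp [torusDerivation, character, torusDerivationAux_single]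

theorem torusDerivation_mem [Module.Free ℤ N] {σ ρ : PointedCone ℚ (RatSpace N)}
    (hfg : σ.FG) (hσ : σ.toConvexCone.Salient) (hρ : IsExtremalRay σ ρ) {v : N}
    (hv : IsPrimitiveVectorOf ρ v) {e : CharLattice N} (he : IsDemazureRoot σ ρ e)
    (f : TorusRing K N) (hf : f ∈ coordinateRing K σ) :
    torusDerivation K v e f ∈ coordinateRing K σ := by
  change torusDerivationAux K v e f ∈ coordinateRing K σ
  simp only [torusDerivationAux, LinearMap.comp_apply, Finsupp.lsum_apply]
  refine sum_mem fun m hm => ?_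
  have hm' : m ∈ dualSemigroup σ := hf m hm
  by_cases h : m v = 0
  · simp [h]
  · have h1 := single_mem_coordinateRing K (he.add_mem hfg hσ hρ hv hm' h) (1 : K)
    exact Subalgebra.smul_mem _ (Subalgebra.smul_mem _ h1 _) _

/-- The derivation `δ_e` of `K[X]` defined by a Demazure root `e` corresponding to the extremal ray
`ρ` with primitive vector `v`: the restriction to `K[X]` of `χ^m ↦ ⟨m, v⟩ χ^{m+e}`. -/
def demazureDerivation [Module.Free ℤ N] {σ ρ : PointedCone ℚ (RatSpace N)}
    (hfg : σ.FG) (hσ : σ.toConvexCone.Salient) (hρ : IsExtremalRay σ ρ) {v : N}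
    (hv : IsPrimitiveVectorOf ρ v) {e : CharLattice N} (he : IsDemazureRoot σ ρ e) :
    Derivation K (coordinateRing K σ) (coordinateRing K σ) :=
  Derivation.mk'
    ((torusDerivation K v e : TorusRing K N →ₗ[K] TorusRing K N).restrict
      (p := (coordinateRing K σ).toSubmodule) (q := (coordinateRing K σ).toSubmodule)
      (torusDerivation_mem K hfg hσ hρ hv he)) <| by
    intro a b
    apply Subtype.ext
    exact (torusDerivation K v e).leibniz a b

@[simp] theorem coe_demazureDerivation [Module.Free ℤ N] {σ ρ : PointedCone ℚ (RatSpace N)}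
    (hfg : σ.FG) (hσ : σ.toConvexCone.Salient) (hρ : IsExtremalRay σ ρ) {v : N}
    (hv : IsPrimitiveVectorOf ρ v) {e : CharLattice N} (he : IsDemazureRoot σ ρ e)
    (f : coordinateRing K σ) :
    (demazureDerivation K hfg hσ hρ hv he f : TorusRing K N) = torusDerivation K v e f := rfl

end Derivations

/-! ### Maximal locally nilpotent derivations -/

section LND

variable {K B : Type*} [CommRing K] [CommRing B] [Algebra K B]

/-- A locally nilpotent derivation (LND): every `f` is killed by some power of `δ`. -/
def IsLND (δ : Derivation K B B) : Prop := ∀ f : B, ∃ n : ℕ, δ^[n] f = 0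

/-- `δ` and `∂` are equivalent if their kernels coincide. -/
def AreEquivalent (δ D : Derivation K B B) : Prop :=
  LinearMap.ker (δ : B →ₗ[K] B) = LinearMap.ker (D : B →ₗ[K] B)

/-- A maximal LND: an LND `δ` such that every nonzero LND commuting with `δ` is equivalent
to `δ`. -/
def IsMaximalLND (δ : Derivation K B B) : Prop :=
  IsLND δ ∧ ∀ D : Derivation K B B, IsLND D → D ≠ 0 → ⁅δ, D⁆ = 0 → AreEquivalent δ D

end LND

end AffineToric

end

/-! Write `δ` for `δ_e`; its kernel is spanned by the `χ^m` with `⟨m, v⟩ = 0`.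

If `e` is orthogonal to an adjacent ray `ρ'`, there is a root `e'` of `ρ'` orthogonal to `v`
(`IsDemazureRoot.exists_adjacent_root`): prescribe the pairings with `v` and `v'`, then add a large
multiple of a character vanishing exactly on the two-dimensional face. The two orthogonality
relations make `δ_{e'}` commute with `δ`, and a character vanishing on `ρ` but not on `ρ'` separates
the kernels, so `δ` is not maximal.

Conversely, let `D` be a nonzero LND commuting with `δ`. By a local slice argument
(`IsLND.areEquivalent_of_commute`) it suffices that `D` kills `ker δ`. For `χ^m` in `ker δ`, every
degree `u` by which `D` shifts it lies in `σ^∨` (`mem_dualSemigroup_of_degreeCoeff_ne_zero`). Hence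
`χ^m` divides `D χ^m`, which forces `D χ^m = 0` for an LND.

The claim on degrees is the heart of the matter. Commutation gives `⟨u, v⟩ = 0`, so if `u ∉ σ^∨`
then `u` is negative on some adjacent ray `ρ'` (`mem_dualSemigroup_of_adjacentRays`). The degree-`u`
coefficient of `D` is additive on `σ^∨ ∩ M` and vanishes on the facet orthogonal to `ρ'`.
Commutation with `δ` makes it vanish also at a point off that facet, because `⟨e, v'⟩ > 0`; so it
vanishes everywhere. -/

namespace AffineToric

/-! ### Locally nilpotent derivations of a domain -/

section LNDAlgebra

variable {K B : Type*} [CommRing K] [CommRing B] [Algebra K B]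

theorem iterate_mul_of_apply_eq_zero (D : Derivation K B B) {f : B} (hf : D f = 0) (n : ℕ) (g : B) :
    D^[n] (f * g) = f * D^[n] g := by
  induction n generalizing g with
  | zero => rfl
  | succ n ih =>
    rw [Function.iterate_succ_apply, D.leibniz, hf, smul_zero, add_zero, smul_eq_mul, ih,
      Function.iterate_succ_apply]

/-- The Leibniz formula for the top nonvanishing iterates of a derivation. -/
theorem iterate_add_mul (D : Derivation K B B) (n m : ℕ) (f g : B)
    (hf : D^[n + 1] f = 0) (hg : D^[m + 1] g = 0) :
    D^[n + m] (f * g) = (n + m).choose n * (D^[n] f * D^[m] g) := by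
  induction n generalizing m f g with
  | zero => simpa using iterate_mul_of_apply_eq_zero D hf m g
  | succ n ihn =>
    induction m generalizing g with
    | zero =>
      rw [mul_comm f g]
      simpa [mul_comm] using iterate_mul_of_apply_eq_zero D hg (n + 1) f
    | succ m ihm =>
      -- After one application of `D` to the product, each summand has one exponent lowered; the two
      -- binomial coefficients add up by Pascal's rule.
      have h1 := ihm (D g) hg
      have h2 := ihn (m + 1) (D f) g hf hg
      rw [show n + 1 + (m + 1) = (n + 1 + m) + 1 by ring, Function.iterate_succ_apply, D.leibniz,
        iterate_map_add, smul_eq_mul, smul_eq_mul, h1, mul_comm g, show n + 1 + m = n + (m + 1) by ring,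
        h2, Nat.choose_succ_succ]
      simp only [Function.iterate_succ_apply]
      push_cast
      ring

theorem IsLND.exists_iterate_ne_zero {D : Derivation K B B} (hD : IsLND D) {f : B} (hf : f ≠ 0) :
    ∃ n : ℕ, D^[n] f ≠ 0 ∧ D^[n + 1] f = 0 := by
  classical
  have hn := Nat.find_spec (hD f)
  rcases h : Nat.find (hD f) with _ | n
  · rw [h] at hn
    exact absurd hn hf
  · rw [h] at hn
    exact ⟨n, Nat.find_min (hD f) (h ▸ n.lt_succ_self), hn⟩

/-- If an LND maps `f` to a multiple of `f`, then it kills `f`. -/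
theorem IsLND.apply_eq_zero_of_dvd [IsDomain B] [CharZero B] {D : Derivation K B B} (hD : IsLND D)
    {f : B} (h : f ∣ D f) : D f = 0 := by
  obtain ⟨g, hg⟩ := h
  by_contra hne
  have hf : f ≠ 0 := by rintro rfl; simp at hne
  have hg0 : g ≠ 0 := by rintro rfl; simp [hg] at hne
  obtain ⟨n, hn, hn'⟩ := hD.exists_iterate_ne_zero hf
  obtain ⟨m, hm, hm'⟩ := hD.exists_iterate_ne_zero hg0
  -- With nilpotency degrees `n` of `f` and `m` of `g`, the iterate `D^[n + m]` does not kill `f * g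
  -- = D f`, although `D^[n + m + 1]` kills `f`.
  have h1 := iterate_add_mul D n m f g hn' hm'
  rw [← hg, ← Function.iterate_succ_apply, show (n + m).succ = m + (n + 1) by omega,
    Function.iterate_add_apply, hn', iterate_map_zero] at h1
  have h2 : (((n + m).choose n : ℕ) : B) ≠ 0 :=
    Nat.cast_ne_zero.2 (Nat.choose_pos (Nat.le_add_right n m)).ne'
  exact mul_ne_zero h2 (mul_ne_zero hn hm) h1.symm

/-- Only two terms of the Leibniz expansion survive. It is applied to a local slice `p`. -/
theorem iterate_mul_of_apply_apply_eq_zero (δ : Derivation K B B) {p : B} (hp : δ (δ p) = 0)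
    (k : ℕ) (g : B) :
    δ^[k + 1] (p * g) = p * δ^[k + 1] g + (k + 1) * (δ p * δ^[k] g) := by
  induction k generalizing g with
  | zero => simp [mul_comm]
  | succ k ih =>
    rw [Function.iterate_succ_apply, δ.leibniz, iterate_map_add, smul_eq_mul, smul_eq_mul, ih,
      mul_comm g, iterate_mul_of_apply_eq_zero δ hp]
    simp only [Function.iterate_succ_apply]
    push_cast
    ring

/-- Two commuting LNDs, the first with kernel contained in that of the second, have the same
kernel unless the second one is zero. -/
theorem IsLND.areEquivalent_of_commute [IsDomain B] [CharZero B] {δ D : Derivation K B B}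
    (hδ : IsLND δ) (hD : D ≠ 0) (hcomm : ⁅δ, D⁆ = 0) (hker : ∀ f, δ f = 0 → D f = 0) :
    AreEquivalent δ D := by
  have hc : ∀ f, D (δ f) = δ (D f) := fun f => by
    have := congrArg (fun E : Derivation K B B => E f) hcomm
    rw [Derivation.commutator_apply] at this
    exact (sub_eq_zero.1 this).symm
  refine le_antisymm (fun f hf => hker f hf) fun f hf => ?_
  by_contra hne
  have hf' : D f = 0 := hf
  have hne' : δ f ≠ 0 := hne
  obtain ⟨n, hn, hn'⟩ := hδ.exists_iterate_ne_zero hne'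
  have hiter : ∀ k, D (δ^[k] f) = 0 := by
    intro k
    induction k with
    | zero => exact hf'
    | succ k ih => rw [Function.iterate_succ_apply', hc, ih, map_zero]
  -- A local slice of `δ` that `D` kills: `δ p ≠ 0`, `δ (δ p) = 0` and `D p = 0`.
  set p := δ^[n] f with hp
  have hp1 : δ p = δ^[n] (δ f) := by
    rw [hp, ← Function.iterate_succ_apply' δ n f, Function.iterate_succ_apply]
  have hp2 : δ (δ p) = 0 := by rw [hp1, ← Function.iterate_succ_apply' δ n (δ f), hn']
  have hp0 : δ p ≠ 0 := hp1 ▸ hn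
  apply hD
  have key : ∀ (k : ℕ) (g : B), δ^[k] g = 0 → D g = 0 := by
    intro k
    induction k with
    | zero => intro g hg; rw [show g = 0 from hg, map_zero]
    | succ k ih =>
      intro g hg
      rcases k with _ | k
      · exact hker g hg
      have hδg : D (δ g) = 0 := ih (δ g) hg
      have hδp : D (δ p) = 0 := hker _ hp2
      -- The correction by `p * δ g` lowers the nilpotency order of `δ p * g` by one. Since `D`
      -- kills `p`, `δ p` and `δ g`, only `(k + 1) * δ p * D g` remains.
      have h1 : D (((k : B) + 1) * (δ p * g) - p * δ g) = 0 := by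
        apply ih
        have h2 : δ ((k : B) + 1) = 0 := by simp
        rw [iterate_map_sub, iterate_mul_of_apply_eq_zero δ h2, iterate_mul_of_apply_eq_zero δ hp2,
          iterate_mul_of_apply_apply_eq_zero δ hp2, ← Function.iterate_succ_apply, hg]
        simp only [Function.iterate_succ_apply]
        ring
      have h3 : D ((k : B) + 1) = 0 := by simp
      rw [map_sub, D.leibniz, D.leibniz, D.leibniz, h3, hδg, hδp, hiter n] at h1
      simp only [smul_eq_mul, mul_zero, add_zero, sub_zero] at h1
      exact ((mul_eq_zero.1 h1).resolve_left (by exact_mod_cast k.succ_ne_zero)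
        |> mul_eq_zero.1).resolve_left hp0
  ext g
  obtain ⟨k, hk⟩ := hδ g
  exact key k g hk

theorem iterate_smul (D : Derivation K B B) (n : ℕ) (c : K) (f : B) :
    D^[n] (c • f) = c • D^[n] f := by
  induction n generalizing f with
  | zero => rfl
  | succ n ih =>
    rw [Function.iterate_succ_apply, Derivation.map_smul, ih, Function.iterate_succ_apply]

/-- The elements killed by some power of a derivation. -/
def nilSubmodule (D : Derivation K B B) : Submodule K B where
  carrier := {f | ∃ n : ℕ, D^[n] f = 0}
  zero_mem' := ⟨0, rfl⟩
  add_mem' := by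
    rintro f g ⟨n, hn⟩ ⟨m, hm⟩
    refine ⟨n + m, ?_⟩
    rw [iterate_map_add, Function.iterate_add_apply D n m g, hm, add_comm n m,
      Function.iterate_add_apply D m n f, hn, iterate_map_zero, iterate_map_zero, add_zero]
  smul_mem' := by
    rintro c f ⟨n, hn⟩
    exact ⟨n, by rw [iterate_smul, hn, smul_zero]⟩

end LNDAlgebra

/-! ### Farkas' lemma and supporting functionals -/

section Farkas

variable {V : Type*} [AddCommGroup V] [Module ℚ V]

theorem nonneg_of_mem_hull {s : Set V} {φ : V →ₗ[ℚ] ℚ} (h : ∀ g ∈ s, 0 ≤ φ g) {x : V}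
    (hx : x ∈ PointedCone.hull ℚ s) : 0 ≤ φ x := by
  have hle : PointedCone.hull ℚ s ≤ (PointedCone.positive ℚ ℚ).comap φ :=
    Submodule.span_le.2 fun g hg => by simpa using h g hg
  simpa using hle hx

theorem mem_hull_insert {s : Set V} {g x : V} :
    x ∈ PointedCone.hull ℚ (insert g s) ↔
      ∃ a : ℚ, 0 ≤ a ∧ ∃ y ∈ PointedCone.hull ℚ s, x = a • g + y := by
  refine Submodule.mem_span_insert.trans ⟨?_, ?_⟩
  · rintro ⟨a, y, hy, rfl⟩
    exact ⟨a, a.2, y, hy, rfl⟩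
  · rintro ⟨a, ha, y, hy, rfl⟩
    exact ⟨⟨a, ha⟩, y, hy, rfl⟩

/-- Farkas' lemma: a point outside a finitely generated cone is separated from it by a linear
functional. -/
theorem exists_separating_functional (G : Finset V) (b : V)
    (hb : b ∉ PointedCone.hull ℚ (G : Set V)) :
    ∃ φ : V →ₗ[ℚ] ℚ, (∀ g ∈ G, 0 ≤ φ g) ∧ φ b < 0 := by
  classical
  induction hn : G.card using Nat.strong_induction_on generalizing G b with
  | _ n ih =>
  rcases G.eq_empty_or_nonempty with rfl | ⟨g, hg⟩
  · have hb0 : b ≠ 0 := by rintro rfl; exact hb (Submodule.zero_mem _)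
    obtain ⟨φ, hφ⟩ : ∃ φ : Module.Dual ℚ V, φ b ≠ 0 := by
      by_contra! h
      exact hb0 ((Module.forall_dual_apply_eq_zero_iff ℚ b).1 h)
    rcases lt_or_gt_of_ne hφ with h | h
    · exact ⟨φ, by simp, h⟩
    · exact ⟨-φ, by simp, by simpa using h⟩
  have hcard := Finset.card_erase_lt_of_mem hg
  have hG : (G : Set V) = insert g ((G.erase g : Finset V) : Set V) := by
    rw [← Finset.coe_insert, Finset.insert_erase hg]
  rw [hG] at hb
  have hb' : b ∉ PointedCone.hull ℚ ((G.erase g : Finset V) : Set V) := fun h =>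
    hb (Submodule.span_mono (Set.subset_insert _ _) h)
  obtain ⟨φ, hφ, hφb⟩ := ih _ (hn ▸ hcard) _ b hb' rfl
  rcases le_or_gt 0 (φ g) with h0 | hneg
  · refine ⟨φ, fun h hh => ?_, hφb⟩
    by_cases hhg : h = g
    · exact hhg ▸ h0
    · exact hφ h (Finset.mem_erase.2 ⟨hhg, hh⟩)
  -- Up to the positive factor `-φ g`, the projection along `g` onto `ker φ`. Functionals pulled
  -- back through it vanish at `g`, so only the remaining generators matter.
  set π : V →ₗ[ℚ] V := φ.smulRight g - φ g • LinearMap.id with hπ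
  have hπx : ∀ x, π x = φ x • g - φ g • x := fun x => rfl
  have hπb : π b ∉ PointedCone.hull ℚ (((G.erase g).image π : Finset V) : Set V) := by
    rw [Finset.coe_image, PointedCone.hull]
    intro hmem
    have hspan := Submodule.map_span (π.restrictScalars {c : ℚ // 0 ≤ c})
      ((G.erase g : Finset V) : Set V)
    obtain ⟨c, hc, hcb⟩ := (hspan.symm ▸ hmem : π b ∈ Submodule.map _ _)
    have hcb' : π c = π b := hcb
    have hφc : 0 ≤ φ c := nonneg_of_mem_hull hφ hc
    apply hb
    refine mem_hull_insert.2 ⟨(φ b - φ c) / φ g, (div_pos_of_neg_of_neg (by linarith) hneg).le,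
      c, hc, ?_⟩
    rw [hπx, hπx] at hcb'
    have h1 : φ g • b = (φ b - φ c) • g + φ g • c := by
      rw [sub_smul, eq_comm, ← sub_eq_zero]
      rw [← sub_eq_zero] at hcb'
      rw [← neg_eq_zero, ← hcb']
      abel
    refine smul_right_injective V hneg.ne ?_
    change φ g • b = φ g • _
    rw [h1, smul_add, smul_smul, mul_div_cancel₀ _ hneg.ne]
  have hcard' : ((G.erase g).image π).card < n := (Finset.card_image_le).trans_lt (hn ▸ hcard)
  obtain ⟨ψ, hψ, hψb⟩ := ih _ hcard' _ _ hπb rfl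
  refine ⟨ψ ∘ₗ π, fun h hh => ?_, hψb⟩
  by_cases hhg : h = g
  · subst hhg
    simp [hπx]
  · exact hψ _ (Finset.mem_image_of_mem _ (Finset.mem_erase.2 ⟨hhg, hh⟩))

/-- A point of a finitely generated cone has a supporting functional: it is nonnegative on the
cone and vanishes only on the smallest face containing the point. -/
theorem exists_supporting_functional (G : Finset V) {x : V}
    (hx : x ∈ PointedCone.hull ℚ (G : Set V)) :
    ∃ φ : V →ₗ[ℚ] ℚ, (∀ g ∈ G, 0 ≤ φ g) ∧ φ x = 0 ∧
      ∀ F : PointedCone ℚ V, F.IsFaceOf (PointedCone.hull ℚ (G : Set V)) → x ∈ F →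
        ∀ g ∈ PointedCone.hull ℚ (G : Set V), φ g = 0 → g ∈ F := by
  classical
  have key : ∀ g : V, ∃ φ : V →ₗ[ℚ] ℚ, (∀ h ∈ G, 0 ≤ φ h) ∧ φ x = 0 ∧ (g ∈ G → φ g = 0 →
      ∀ F : PointedCone ℚ V, F.IsFaceOf (PointedCone.hull ℚ (G : Set V)) → x ∈ F → g ∈ F) := by
    intro g
    -- If so, `g + y = a • x` with `y` in the cone, so `g` lies in every face containing `x`. If
    -- not, Farkas gives a functional nonnegative on `G`, zero at `x` and positive at `g`; summing
    -- over `G` handles all generators at once.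
    by_cases hg : -g ∈ PointedCone.hull ℚ ((insert (-x) G : Finset V) : Set V)
    · refine ⟨0, by simp, rfl, fun hgG _ F hF hxF => ?_⟩
      rw [Finset.coe_insert] at hg
      obtain ⟨a, ha, y, hy, h⟩ := mem_hull_insert.1 hg
      refine hF.mem_of_add_mem_left (Submodule.subset_span hgG) hy ?_
      have : g + y = a • x := by
        rw [← neg_neg g, h, smul_neg]; abel
      rw [this]
      exact PointedCone.smul_mem _ ha hxF
    · obtain ⟨φ, hφ, hφg⟩ := exists_separating_functional _ _ hg
      have h1 : ∀ h ∈ G, 0 ≤ φ h := fun h hh => hφ h (Finset.mem_insert_of_mem hh)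
      have h2 : 0 ≤ φ x := nonneg_of_mem_hull h1 hx
      have h3 := hφ (-x) (Finset.mem_insert_self _ _)
      rw [map_neg] at h3 hφg
      exact ⟨φ, h1, by linarith, fun _ h0 => by linarith⟩
  choose φ h1 h2 h3 using key
  have hnn : ∀ g ∈ G, 0 ≤ (∑ h ∈ G, φ h) g := fun g hg => by
    rw [LinearMap.sum_apply]
    exact Finset.sum_nonneg fun h _ => h1 h g hg
  refine ⟨∑ g ∈ G, φ g, hnn, by simp [h2], fun F hF hxF g hg => ?_⟩
  induction hg using Submodule.span_induction with
  | mem g hg =>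
    intro h0
    rw [LinearMap.sum_apply, Finset.sum_eq_zero_iff_of_nonneg fun h _ => h1 h g hg] at h0
    exact h3 g hg (h0 g hg) F hF hxF
  | zero => exact fun _ => F.zero_mem
  | add y z hy hz ihy ihz =>
    intro h0
    have hy0 := nonneg_of_mem_hull hnn hy
    have hz0 := nonneg_of_mem_hull hnn hz
    rw [map_add] at h0
    exact F.add_mem (ihy (by linarith)) (ihz (by linarith))
  | smul a y hy ih =>
    intro h0
    have h0' : (a : ℚ) * (∑ h ∈ G, φ h) y = 0 := by
      rw [← smul_eq_mul, ← map_smul]; exact h0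
    rcases mul_eq_zero.1 h0' with ha | hy0
    · rw [show a = 0 from Subtype.ext ha, zero_smul]
      exact F.zero_mem
    · exact PointedCone.smul_mem F a.2 (ih hy0)

theorem exists_nat_forall_nonneg (G : Finset V) (m t : V →ₗ[ℚ] ℚ) (ht : ∀ g ∈ G, 0 ≤ t g)
    (h : ∀ g ∈ G, t g = 0 → 0 ≤ m g) : ∃ k : ℕ, ∀ g ∈ G, 0 ≤ m g + k * t g := by
  classical
  induction G using Finset.induction_on with
  | empty => exact ⟨0, by simp⟩
  | insert g G _ ih =>
    obtain ⟨k, hk⟩ := ih (fun g hg => ht g (Finset.mem_insert_of_mem hg))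
      (fun g hg => h g (Finset.mem_insert_of_mem hg))
    have hg := ht g (Finset.mem_insert_self _ _)
    obtain ⟨l, hl⟩ : ∃ l : ℕ, 0 ≤ m g + l * t g := by
      rcases hg.eq_or_lt with h0 | hpos
      · exact ⟨0, by simpa using h g (Finset.mem_insert_self _ _) h0.symm⟩
      · obtain ⟨l, hl⟩ := exists_nat_ge (-m g / t g)
        exact ⟨l, by rw [div_le_iff₀ hpos] at hl; linarith⟩
    refine ⟨k + l, fun y hy => ?_⟩
    have hty := ht y hy
    push_cast
    have hkn : (0 : ℚ) ≤ k := k.cast_nonneg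
    have hln : (0 : ℚ) ≤ l := l.cast_nonneg
    rcases Finset.mem_insert.1 hy with rfl | hy
    · nlinarith [mul_nonneg hkn hty]
    · nlinarith [hk y hy, mul_nonneg hln hty]

/-- A face of a cone is generated by the generators of the cone that it contains. -/
theorem mem_hull_inter_of_isFaceOf {s : Set V} {F : PointedCone ℚ V}
    (hF : F.IsFaceOf (PointedCone.hull ℚ s)) {x : V} (hx : x ∈ F) :
    x ∈ PointedCone.hull ℚ (s ∩ F) := by
  have hxs := hF.le hx
  induction hxs using Submodule.span_induction with
  | mem g hg => exact Submodule.subset_span ⟨hg, hx⟩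
  | zero => exact Submodule.zero_mem _
  | add y z hy hz ihy ihz =>
    exact Submodule.add_mem _ (ihy (hF.mem_of_add_mem_left hy hz hx))
      (ihz (hF.mem_of_add_mem_right hy hz hx))
  | smul a y hy ih =>
    rcases a.2.eq_or_lt with ha | ha
    · rw [show a = 0 from Subtype.ext ha.symm, zero_smul]
      exact Submodule.zero_mem _
    · refine Submodule.smul_mem _ a (ih ?_)
      exact hF.mem_of_smul_add_mem (a := (a : ℚ)) (y := 0) hy (Submodule.zero_mem _) ha
        (by simpa using hx)

end Farkas

/-! ### Primitive vectors, extremal rays and supporting characters -/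

section Rays

variable {N : Type*} [AddCommGroup N]

/-- The values of characters at `v` form a principal ideal. Its generator divides all coordinates of
`v`, so primitivity makes it a unit. -/
theorem IsPrimitive.exists_apply_eq_one [Module.Free ℤ N] [Module.Finite ℤ N] {v : N}
    (hv : IsPrimitive v) : ∃ f : CharLattice N, f v = 1 := by
  obtain ⟨d, hd⟩ := (IsPrincipalIdealRing.principal
    (LinearMap.range (Module.Dual.eval ℤ N v))).principal
  set b := Module.Free.chooseBasis ℤ N
  have hdvd : ∀ i, d ∣ b.repr v i := fun i => by
    have : b.repr v i ∈ LinearMap.range (Module.Dual.eval ℤ N v) := ⟨b.coord i, rfl⟩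
    rw [hd] at this
    exact Ideal.mem_span_singleton.1 this
  choose c hc using hdvd
  have hdu : IsUnit d := by
    refine hv d (∑ i, c i • b i) ?_
    rw [Finset.smul_sum]
    conv_lhs => rw [← b.sum_repr v]
    exact Finset.sum_congr rfl fun i _ => by rw [hc, mul_smul]
  have : (1 : ℤ) ∈ LinearMap.range (Module.Dual.eval ℤ N v) := by
    rw [hd]
    exact Ideal.mem_span_singleton.2 hdu.dvd
  obtain ⟨f, hf⟩ := this
  exact ⟨f, hf⟩

theorem IsPrimitive.toRat_ne_zero [Module.Free ℤ N] [Module.Finite ℤ N] {v : N}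
    (hv : IsPrimitive v) : toRat v ≠ 0 := by
  obtain ⟨f, hf⟩ := hv.exists_apply_eq_one
  intro h
  have := ratPairing_toRat f v
  rw [h, hf] at this
  simp at this

/-- Every functional on `N_ℚ` has a positive multiple in the lattice `M`. -/
theorem exists_charLattice [Module.Free ℤ N] [Module.Finite ℤ N] (φ : RatSpace N →ₗ[ℚ] ℚ) :
    ∃ d : ℕ, 0 < d ∧ ∃ m : CharLattice N, ratPairing m = (d : ℚ) • φ := by
  classical
  set b := Module.Free.chooseBasis ℤ N
  set d : ℕ := ∏ i, (φ (toRat (b i))).den with hd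
  have hint : ∀ i, ∃ z : ℤ, (z : ℚ) = d * φ (toRat (b i)) := fun i => by
    obtain ⟨k, hk⟩ := Finset.dvd_prod_of_mem (fun i => (φ (toRat (b i))).den) (Finset.mem_univ i)
    refine ⟨k * (φ (toRat (b i))).num, ?_⟩
    rw [hd, hk]
    push_cast
    rw [mul_comm ((φ (toRat (b i))).den : ℚ), mul_assoc, Rat.den_mul_eq_num]
  choose z hz using hint
  refine ⟨d, Finset.prod_pos fun i _ => Rat.den_pos _, b.constr ℤ z, ?_⟩
  have hext : ∀ w : N, ratPairing (b.constr ℤ z) (toRat w) = ((d : ℚ) • φ) (toRat w) := by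
    intro w
    have h1 : ((AddMonoidHom.toIntLinearMap (Int.castAddHom ℚ)) ∘ₗ (b.constr ℤ z) : N →ₗ[ℤ] ℚ) =
        (((d : ℚ) • φ).restrictScalars ℤ) ∘ₗ (TensorProduct.mk ℤ ℚ N 1) := by
      refine b.ext fun i => ?_
      simp only [LinearMap.comp_apply, Module.Basis.constr_basis]
      exact hz i
    rw [ratPairing_toRat]
    exact LinearMap.congr_fun h1 w
  refine LinearMap.ext fun x => ?_
  obtain ⟨k, hk, w, hw⟩ := exists_smul_eq_toRat x
  have hkQ : (k : ℚ) ≠ 0 := by exact_mod_cast hk.ne'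
  rw [← inv_smul_smul₀ hkQ x, hw, map_smul, map_smul, hext]

variable {σ ρ ρ' : PointedCone ℚ (RatSpace N)}

theorem IsExtremalRay.exists_smul (hσ : σ.toConvexCone.Salient) (hρ : IsExtremalRay σ ρ)
    {x y : RatSpace N} (hx : x ∈ ρ) (hx0 : x ≠ 0) (hy : y ∈ ρ) : ∃ c : ℚ, 0 ≤ c ∧ y = c • x := by
  obtain ⟨c, hc⟩ := exists_smul_eq_of_finrank_eq_one hρ.2
    (x := ⟨x, Submodule.subset_span hx⟩) (by simpa [Subtype.ext_iff] using hx0)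
    ⟨y, Submodule.subset_span hy⟩
  have hc' : c • x = y := congrArg Subtype.val hc
  rcases le_or_gt 0 c with h | h
  · exact ⟨c, h, hc'.symm⟩
  · exfalso
    refine hσ x (hρ.1.le hx) hx0 ?_
    have : -x = (-c)⁻¹ • y := by
      rw [← hc', smul_smul, inv_neg, neg_mul, inv_mul_cancel₀ h.ne, neg_one_smul]
    rw [this]
    exact PointedCone.smul_mem σ (inv_nonneg.2 (by linarith)) (hρ.1.le hy)

theorem IsExtremalRay.eq_of_mem (hσ : σ.toConvexCone.Salient) (hρ : IsExtremalRay σ ρ)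
    (hρ' : IsExtremalRay σ ρ') {x : RatSpace N} (hx : x ∈ ρ) (hx' : x ∈ ρ') (hx0 : x ≠ 0) :
    ρ = ρ' := by
  refine le_antisymm (fun y hy => ?_) fun y hy => ?_
  · obtain ⟨c, hc, rfl⟩ := hρ.exists_smul hσ hx hx0 hy
    exact PointedCone.smul_mem _ hc hx'
  · obtain ⟨c, hc, rfl⟩ := hρ'.exists_smul hσ hx' hx0 hy
    exact PointedCone.smul_mem _ hc hx

/-- A two-dimensional face is generated by any two distinct extremal rays in it. -/
theorem exists_smul_add_smul_of_coneDim_eq_two [Module.Finite ℤ N]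
    (hσ : σ.toConvexCone.Salient) (hρ : IsExtremalRay σ ρ) (hρ' : IsExtremalRay σ ρ')
    (hne : ρ' ≠ ρ) {F : PointedCone ℚ (RatSpace N)} (hF : F.IsFaceOf σ) (hdim : coneDim F = 2)
    (hρF : ρ ≤ F) (hρF' : ρ' ≤ F) {x x' : RatSpace N} (hx : x ∈ ρ) (hx0 : x ≠ 0) (hx' : x' ∈ ρ')
    (hx0' : x' ≠ 0) {y : RatSpace N} (hy : y ∈ F) :
    ∃ a b : ℚ, 0 ≤ a ∧ 0 ≤ b ∧ y = a • x + b • x' := by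
  have hxσ := hρ.1.le hx
  have hxσ' := hρ'.1.le hx'
  have hxρ' : x ∉ ρ' := fun h => hne (hρ'.eq_of_mem hσ hρ h hx hx0)
  have hxρ : x' ∉ ρ := fun h => hne (hρ'.eq_of_mem hσ hρ hx' h hx0')
  have hli : LinearIndependent ℚ ![x, x'] := by
    refine (LinearIndependent.pair_iff' hx0).2 fun a ha => ?_
    rcases le_or_gt 0 a with h | h
    · exact hxρ (ha ▸ PointedCone.smul_mem _ h hx)
    · refine hσ x' hxσ' hx0' ?_
      rw [← ha, ← neg_smul]
      exact PointedCone.smul_mem _ (by linarith) hxσ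
  have hspan : Submodule.span ℚ (Set.range ![x, x']) =
      Submodule.span ℚ (F : Set (RatSpace N)) := by
    refine Submodule.eq_of_le_of_finrank_eq (Submodule.span_mono ?_) ?_
    · rintro _ ⟨i, rfl⟩
      fin_cases i
      · exact hρF hx
      · exact hρF' hx'
    · rw [finrank_span_eq_card hli, Fintype.card_fin]
      exact hdim.symm
  have hy' : y ∈ Submodule.span ℚ (Set.range ![x, x']) := hspan ▸ Submodule.subset_span hy
  rw [Matrix.range_cons, Matrix.range_cons, Matrix.range_empty, Set.union_empty,
    Set.singleton_union, Submodule.mem_span_pair] at hy'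
  obtain ⟨a, b, rfl⟩ := hy'
  have hyσ := hF.le hy
  refine ⟨a, b, ?_, ?_, rfl⟩
  -- A negative coefficient moves to the other side: `y + (-a) • x` is then `b • x'` in `ρ'`, and
  -- the face property puts `x` in `ρ'`. If `b` is negative too, moving both terms gives `0`.
  · by_contra! ha
    rcases le_or_gt 0 b with hb | hb
    · refine hxρ' (hρ'.1.mem_of_smul_add_mem (a := -a) hxσ hyσ (by linarith) ?_)
      rw [neg_smul, neg_add_cancel_left]
      exact PointedCone.smul_mem _ hb hx'
    · refine hxρ' (hρ'.1.mem_of_smul_add_mem (a := -a) hxσ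
        (σ.add_mem hyσ (PointedCone.smul_mem _ (show 0 ≤ -b by linarith) hxσ')) (by linarith) ?_)
      convert ρ'.zero_mem using 1
      module
  · by_contra! hb
    rcases le_or_gt 0 a with ha | ha
    · refine hxρ (hρ.1.mem_of_smul_add_mem (a := -b) hxσ' hyσ (by linarith) ?_)
      rw [neg_smul, add_comm (a • x), neg_add_cancel_left]
      exact PointedCone.smul_mem _ ha hx
    · refine hxρ (hρ.1.mem_of_smul_add_mem (a := -b) hxσ'
        (σ.add_mem hyσ (PointedCone.smul_mem _ (show 0 ≤ -a by linarith) hxσ)) (by linarith) ?_)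
      convert ρ.zero_mem using 1
      module

/-- A pointed rational polyhedral cone is generated by finitely many primitive vectors on its
extremal rays. -/
theorem exists_finset_primitive [Module.Free ℤ N] (hfg : σ.FG) (hσ : σ.toConvexCone.Salient) :
    ∃ G : Finset (RatSpace N), PointedCone.hull ℚ (G : Set (RatSpace N)) = σ ∧
      ∀ g ∈ G, ∃ ρ v, IsExtremalRay σ ρ ∧ IsPrimitiveVectorOf ρ v ∧ g = toRat v := by
  set E := {x | ∃ ρ v, IsExtremalRay σ ρ ∧ IsPrimitiveVectorOf ρ v ∧ x = toRat v} with hE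
  have h1 : PointedCone.hull ℚ E = σ := by
    refine le_antisymm (Submodule.span_le.2 ?_) (eq_hull_primitive σ hfg hσ)
    rintro _ ⟨ρ, v, hρ, hv, rfl⟩
    exact hρ.1.le hv.2
  obtain ⟨G, hGE, hG⟩ := (Submodule.fg_span_iff_fg_span_finset_subset E).1
    (show (PointedCone.hull ℚ E).FG from h1 ▸ hfg)
  exact ⟨G, (hG.symm.trans h1 : PointedCone.hull ℚ (G : Set (RatSpace N)) = σ),
    fun g hg => hGE hg⟩

/-- A point of `σ` has a supporting character: an element of `σ^∨ ∩ M` that vanishes only on the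
smallest face containing the point. -/
theorem exists_supporting_character [Module.Free ℤ N] [Module.Finite ℤ N] (hfg : σ.FG)
    {x : RatSpace N} (hx : x ∈ σ) :
    ∃ t ∈ dualSemigroup σ, ratPairing t x = 0 ∧
      ∀ F : PointedCone ℚ (RatSpace N), F.IsFaceOf σ → x ∈ F →
        ∀ g ∈ σ, ratPairing t g = 0 → g ∈ F := by
  obtain ⟨G, hG⟩ := hfg
  replace hG : PointedCone.hull ℚ (G : Set (RatSpace N)) = σ := hG
  subst hG
  obtain ⟨φ, h1, h2, h3⟩ := exists_supporting_functional G hx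
  obtain ⟨d, hd, t, ht⟩ := exists_charLattice φ
  have hdQ : (0 : ℚ) < d := by exact_mod_cast hd
  refine ⟨t, fun y hy => ?_, by simp [ht, h2], fun F hF hxF g hg h0 => h3 F hF hxF g hg ?_⟩
  · rw [ht]
    exact mul_nonneg hdQ.le (nonneg_of_mem_hull h1 hy)
  · rw [ht] at h0
    exact (mul_eq_zero.1 h0).resolve_left hdQ.ne'

@[simp] theorem ratPairing_add (m n : CharLattice N) :
    ratPairing (m + n) = ratPairing m + ratPairing n := by
  simp [ratPairing]

@[simp] theorem ratPairing_nsmul (k : ℕ) (m : CharLattice N) :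
    ratPairing (k • m) = (k : ℚ) • ratPairing m := by
  refine LinearMap.ext fun x => ?_
  simp [ratPairing, Nat.cast_smul_eq_nsmul]

/-- On the finitely many generators where `t` is positive, a large multiple of `t` outweighs `m`; on
the others `m` is already nonnegative. -/
theorem exists_add_nsmul_mem_dualSemigroup (hfg : σ.FG) {t : CharLattice N}
    (ht : t ∈ dualSemigroup σ) (m : CharLattice N)
    (h : ∀ g ∈ σ, ratPairing t g = 0 → 0 ≤ ratPairing m g) :
    ∃ k : ℕ, m + k • t ∈ dualSemigroup σ := by
  obtain ⟨G, hG⟩ := hfg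
  replace hG : PointedCone.hull ℚ (G : Set (RatSpace N)) = σ := hG
  subst hG
  obtain ⟨k, hk⟩ := exists_nat_forall_nonneg G (ratPairing m) (ratPairing t)
    (fun g hg => ht g (Submodule.subset_span hg)) fun g hg => h g (Submodule.subset_span hg)
  refine ⟨k, fun x hx => nonneg_of_mem_hull (fun g hg => ?_) hx⟩
  simpa using hk g hg

end Rays

/-! ### Adjacent rays and the cone modulo the line of a ray -/

section Adjacent

variable {N : Type*} [AddCommGroup N] {σ ρ ρ' : PointedCone ℚ (RatSpace N)}

/-- The primitive vector of a ray is unique. -/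
theorem IsExtremalRay.toRat_eq [Module.Free ℤ N] [Module.Finite ℤ N]
    (hσ : σ.toConvexCone.Salient) (hρ : IsExtremalRay σ ρ) {v w : N}
    (hv : IsPrimitiveVectorOf ρ v) (hw : IsPrimitiveVectorOf ρ w) : toRat v = toRat w := by
  obtain ⟨c, hc, h⟩ := hρ.exists_smul hσ hw.2 hw.1.toRat_ne_zero hv.2
  obtain ⟨f, hf⟩ := hv.1.exists_apply_eq_one
  obtain ⟨g, hg⟩ := hw.1.exists_apply_eq_one
  have h1 : ((1 : ℤ) : ℚ) = c * f w := by
    rw [← hf, ← ratPairing_toRat, h, map_smul, ratPairing_toRat, smul_eq_mul]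
  have h2 : ((g v : ℤ) : ℚ) = c := by
    rw [← ratPairing_toRat, h, map_smul, ratPairing_toRat, hg, smul_eq_mul, Int.cast_one, mul_one]
  -- The ratio `c` of the two vectors is the integer `g v`, nonnegative and invertible, hence `1`.
  rw [← h2] at h1 hc
  have h3 : g v = 1 :=
    Int.eq_one_of_mul_eq_one_right (by exact_mod_cast hc) (by exact_mod_cast h1.symm)
  rw [h, ← h2, h3, Int.cast_one, one_smul]

/-- The points of `σ` in the plane spanned by `x` and `g` on the side of `g`. -/
def halfPlaneFace (σ : PointedCone ℚ (RatSpace N)) (x g : RatSpace N) :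
    PointedCone ℚ (RatSpace N) where
  carrier := {y | y ∈ σ ∧ ∃ a b : ℚ, 0 ≤ a ∧ y = a • g + b • x}
  zero_mem' := ⟨σ.zero_mem, 0, 0, le_rfl, by simp⟩
  add_mem' := by
    rintro _ _ ⟨hy, a, b, ha, rfl⟩ ⟨hz, c, d, hc, rfl⟩
    exact ⟨σ.add_mem hy hz, a + c, b + d, add_nonneg ha hc, by module⟩
  smul_mem' := by
    rintro c _ ⟨hy, a, b, ha, rfl⟩
    refine ⟨PointedCone.smul_mem σ c.2 hy, c * a, c * b, mul_nonneg c.2 ha, ?_⟩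
    change (c : ℚ) • (a • g + b • x) = _
    module

theorem coneDim_halfPlaneFace {x g : RatSpace N} (hx : x ∈ σ) (hg : g ∈ σ) (hx0 : x ≠ 0)
    (hgx : ∀ c : ℚ, c • x ≠ g) : coneDim (halfPlaneFace σ x g) = 2 := by
  have hli : LinearIndependent ℚ ![x, g] := (LinearIndependent.pair_iff' hx0).2 hgx
  have hspan : Submodule.span ℚ (halfPlaneFace σ x g : Set (RatSpace N)) =
      Submodule.span ℚ (Set.range ![x, g]) := by
    refine le_antisymm (Submodule.span_le.2 ?_) (Submodule.span_mono ?_)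
    · rintro _ ⟨_, a, b, _, rfl⟩
      exact Submodule.add_mem _ (Submodule.smul_mem _ a (Submodule.subset_span ⟨1, rfl⟩))
        (Submodule.smul_mem _ b (Submodule.subset_span ⟨0, rfl⟩))
    · rintro _ ⟨i, rfl⟩
      fin_cases i
      · exact ⟨hx, 0, 1, le_rfl, by simp⟩
      · exact ⟨hg, 1, 0, zero_le_one, by simp⟩
  rw [coneDim, hspan, finrank_span_eq_card hli, Fintype.card_fin]

/-- If `g` is not in the cone `C` modulo the line of the extremal ray `ρ`, but `g` and `C` generate
`σ` modulo that line, then the points of `σ` in the half-plane of `g` form a face. -/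
theorem isFaceOf_halfPlaneFace (hσ : σ.toConvexCone.Salient) (hρ : IsExtremalRay σ ρ)
    {x g : RatSpace N} (hx : x ∈ ρ) (hx0 : x ≠ 0) {C : PointedCone ℚ (RatSpace N)} (hC : C ≤ σ)
    (hg : g ∈ σ) (hgen : ∀ y ∈ σ, ∃ a : ℚ, 0 ≤ a ∧ ∃ c ∈ C, ∃ s : ℚ, y = a • g + c + s • x)
    (hgC : ∀ c ∈ C, ∀ s : ℚ, g ≠ c + s • x) : (halfPlaneFace σ x g).IsFaceOf σ := by
  refine PointedCone.IsFaceOf.of_mem_of_add_mem_left (fun y hy => hy.1) ?_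
  rintro y z hy hz ⟨-, a, b, ha, hab⟩
  refine ⟨hy, ?_⟩
  obtain ⟨a₁, ha₁, c₁, hc₁, s₁, rfl⟩ := hgen y hy
  obtain ⟨a₂, ha₂, c₂, hc₂, s₂, rfl⟩ := hgen z hz
  have h1 : (a - a₁ - a₂) • g = (c₁ + c₂) + (s₁ + s₂ - b) • x := by
    have : a • g = a₁ • g + c₁ + s₁ • x + (a₂ • g + c₂ + s₂ • x) - b • x := by
      rw [hab]; abel
    rw [sub_smul, sub_smul, this]
    module
  -- A positive coefficient would put `g` in `C` modulo the line of `x`. Otherwise `c₁` plus an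
  -- element of `σ` is a multiple of `x`, nonnegative by salience, so `c₁` lies on `ρ`.
  rcases lt_or_ge 0 (a - a₁ - a₂) with hpos | hneg
  · exfalso
    refine hgC ((a - a₁ - a₂)⁻¹ • (c₁ + c₂))
      (PointedCone.smul_mem _ (inv_nonneg.2 hpos.le) (C.add_mem hc₁ hc₂))
      ((a - a₁ - a₂)⁻¹ * (s₁ + s₂ - b)) ?_
    rw [mul_smul, ← smul_add, ← h1, inv_smul_smul₀ hpos.ne']
  · set w := c₂ + (a₁ + a₂ - a) • g with hw
    have hwσ : w ∈ σ := σ.add_mem (hC hc₂) (PointedCone.smul_mem _ (by linarith) hg)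
    have h2 : c₁ + w = (b - s₁ - s₂) • x := by
      have h3 : c₁ + c₂ = (a - a₁ - a₂) • g - (s₁ + s₂ - b) • x := by rw [h1]; abel
      rw [hw, ← add_assoc, h3]
      module
    have hc₁ρ : c₁ ∈ ρ := by
      rcases le_or_gt 0 (b - s₁ - s₂) with h | h
      · refine hρ.1.mem_of_add_mem_left (hC hc₁) hwσ ?_
        rw [h2]
        exact PointedCone.smul_mem _ h hx
      · exfalso
        refine hσ x (hρ.1.le hx) hx0 ?_
        have : -x = (-(b - s₁ - s₂))⁻¹ • (c₁ + w) := by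
          rw [h2, smul_smul, inv_neg, neg_mul, inv_mul_cancel₀ h.ne, neg_one_smul]
        rw [this]
        exact PointedCone.smul_mem σ (inv_nonneg.2 (by linarith)) (σ.add_mem (hC hc₁) hwσ)
    obtain ⟨r, -, rfl⟩ := hρ.exists_smul hσ hx hx0 hc₁ρ
    exact ⟨a₁, r + s₁, ha₁, by module⟩

/-- Modulo the line of an extremal ray `ρ`, the cone `σ` is generated by the rays adjacent
to `ρ`. -/
theorem mem_dualSemigroup_of_adjacentRays [Module.Free ℤ N] [Module.Finite ℤ N] (hfg : σ.FG)
    (hσ : σ.toConvexCone.Salient) (hρ : IsExtremalRay σ ρ) {v : N} (hv : IsPrimitiveVectorOf ρ v)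
    {u : CharLattice N} (huv : u v = 0)
    (hu : ∀ ρ' ∈ adjacentRays σ ρ, ∀ v', IsPrimitiveVectorOf ρ' v' → 0 ≤ u v') :
    u ∈ dualSemigroup σ := by
  classical
  set x := toRat v with hx
  have hx0 : x ≠ 0 := hv.1.toRat_ne_zero
  -- Take a smallest set of primitive ray vectors generating `σ` modulo the line of `x`. By
  -- minimality each one satisfies the hypotheses of `isFaceOf_halfPlaneFace`, so its ray is
  -- adjacent to `ρ`; and `u` does not see the line, since `u v = 0`.
  have hex : ∃ n : ℕ, ∃ G : Finset (RatSpace N), G.card = n ∧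
      (∀ y ∈ σ, ∃ c ∈ PointedCone.hull ℚ (G : Set (RatSpace N)), ∃ s : ℚ, y = c + s • x) ∧
      ∀ g ∈ G, ∃ ρ v, IsExtremalRay σ ρ ∧ IsPrimitiveVectorOf ρ v ∧ g = toRat v := by
    obtain ⟨G, hG, hG'⟩ := exists_finset_primitive hfg hσ
    exact ⟨_, G, rfl, fun y hy => ⟨y, hG ▸ hy, 0, by simp⟩, hG'⟩
  obtain ⟨G, hcard, hG, hGr⟩ := Nat.find_spec hex
  have hGu : ∀ g ∈ G, 0 ≤ ratPairing u g := by
    intro g hg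
    set C := PointedCone.hull ℚ ((G.erase g : Finset (RatSpace N)) : Set (RatSpace N)) with hC
    have hins : (G : Set (RatSpace N)) = insert g ((G.erase g : Finset _) : Set (RatSpace N)) := by
      rw [← Finset.coe_insert, Finset.insert_erase hg]
    have hgen : ∀ y ∈ σ, ∃ a : ℚ, 0 ≤ a ∧ ∃ c ∈ C, ∃ s : ℚ, y = a • g + c + s • x := by
      intro y hy
      obtain ⟨c, hc, s, rfl⟩ := hG y hy
      rw [hins] at hc
      obtain ⟨a, ha, c, hcC, rfl⟩ := mem_hull_insert.1 hc
      exact ⟨a, ha, c, hcC, s, rfl⟩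
    have hgC : ∀ c ∈ C, ∀ s : ℚ, g ≠ c + s • x := by
      intro c hc s hgc
      refine absurd (Nat.find_min' hex (m := (G.erase g).card) ⟨G.erase g, rfl, ?_, fun h hh =>
        hGr h (Finset.mem_of_mem_erase hh)⟩) ?_
      · intro y hy
        obtain ⟨a, ha, c', hc', s', rfl⟩ := hgen y hy
        exact ⟨a • c + c', C.add_mem (PointedCone.smul_mem _ ha hc) hc', a * s + s', by
          rw [hgc]; module⟩
      · rw [← hcard, not_le]
        exact Finset.card_erase_lt_of_mem hg
    obtain ⟨ρ', v', hρ', hv', hgv⟩ := hGr g hg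
    have hgρ' : g ∈ ρ' := hgv ▸ hv'.2
    have hgσ : g ∈ σ := hρ'.1.le hgρ'
    have hgx : ∀ c : ℚ, c • x ≠ g := fun c hc => hgC 0 C.zero_mem c (by rw [zero_add, hc])
    have hCσ : C ≤ σ := Submodule.span_le.2 fun h hh => by
      obtain ⟨ρ₁, v₁, h1, h2, rfl⟩ := hGr h (Finset.mem_of_mem_erase hh)
      exact h1.1.le h2.2
    have hxσ := hρ.1.le hv.2
    have hadj : ρ' ∈ adjacentRays σ ρ := by
      refine ⟨hρ', ?_, halfPlaneFace σ x g,
        isFaceOf_halfPlaneFace hσ hρ hv.2 hx0 hCσ hgσ hgen hgC,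
        coneDim_halfPlaneFace hxσ hgσ hx0 hgx, ?_, ?_⟩
      · rintro rfl
        obtain ⟨c, -, hc⟩ := hρ.exists_smul hσ hv.2 hx0 hgρ'
        exact hgx c hc.symm
      · intro y hy
        obtain ⟨c, -, rfl⟩ := hρ.exists_smul hσ hv.2 hx0 hy
        exact ⟨hρ.1.le hy, 0, c, le_rfl, by rw [zero_smul, zero_add]⟩
      · intro y hy
        obtain ⟨c, hc, rfl⟩ := hρ'.exists_smul hσ hgρ' (hgv ▸ hv'.1.toRat_ne_zero) hy
        exact ⟨hρ'.1.le hy, c, 0, hc, by rw [zero_smul, add_zero]⟩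
    rw [hgv, ratPairing_toRat]
    exact_mod_cast hu ρ' hadj v' hv'
  intro y hy
  obtain ⟨c, hc, s, rfl⟩ := hG y hy
  rw [map_add, map_smul, hx, ratPairing_toRat, huv]
  simpa using nonneg_of_mem_hull hGu hc

/-- A Demazure root `e` of `ρ` orthogonal to an adjacent ray `ρ'` yields a Demazure root of `ρ'`
orthogonal to `ρ`. -/
theorem IsDemazureRoot.exists_adjacent_root [Module.Free ℤ N] [Module.Finite ℤ N] (hfg : σ.FG)
    (hσ : σ.toConvexCone.Salient) (hρ : IsExtremalRay σ ρ) {v : N} (hv : IsPrimitiveVectorOf ρ v)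
    {e : CharLattice N} (he : IsDemazureRoot σ ρ e) (hρ' : ρ' ∈ adjacentRays σ ρ) {v' : N}
    (hv' : IsPrimitiveVectorOf ρ' v') (hev' : e v' = 0) :
    ∃ e' : CharLattice N, IsDemazureRoot σ ρ' e' ∧ e' v = 0 := by
  obtain ⟨hρ', hne, F, hF, hdim, hρF, hρF'⟩ := hρ'
  have hx0 : toRat v ≠ 0 := hv.1.toRat_ne_zero
  have hx0' : toRat v' ≠ 0 := hv'.1.toRat_ne_zero
  have hev : e v = -1 := he.pairing_self v hv
  obtain ⟨f, hf⟩ := hv'.1.exists_apply_eq_one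
  -- The multiple of `e` cancels the pairing with `v`, as `e v = -1`, and leaves the pairing with
  -- `v'` at `-1`, as `e v' = 0`.
  set e₀ : CharLattice N := -f - f v • e with he₀
  have he₀v : e₀ v = 0 := by simp [he₀, hev]
  have he₀v' : e₀ v' = -1 := by simp [he₀, hev', hf]
  have hxσ := hρ.1.le hv.2
  have hxσ' := hρ'.1.le hv'.2
  obtain ⟨t, ht, ht0, htF⟩ := exists_supporting_character hfg (σ.add_mem hxσ hxσ')
  rw [map_add, ratPairing_toRat, ratPairing_toRat] at ht0
  have htv0 := apply_nonneg_of_mem_dualSemigroup ht hρ hv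
  have htv0' := apply_nonneg_of_mem_dualSemigroup ht hρ' hv'
  have ht0' : t v + t v' = 0 := by exact_mod_cast ht0
  have htv : t v = 0 := by omega
  have htv' : t v' = 0 := by omega
  obtain ⟨G, hG, -⟩ := exists_finset_primitive hfg hσ
  have hGσ : ∀ g ∈ G, g ∈ σ := fun g hg => hG ▸ Submodule.subset_span hg
  classical
  -- The generators that a multiple of `t` can make nonnegative. An excluded one lies in `F` and has
  -- a positive `v'`-component, so no extremal ray other than `ρ'` contains it.
  set G' := G.filter fun g => 0 ≤ ratPairing e₀ g ∨ ratPairing t g ≠ 0 with hG'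
  obtain ⟨k, hk⟩ := exists_nat_forall_nonneg G' (ratPairing e₀) (ratPairing t)
    (fun g hg => ht g (hGσ g (Finset.mem_filter.1 hg).1))
    (fun g hg h0 => (Finset.mem_filter.1 hg).2.resolve_right (not_not.2 h0))
  have hval : (e₀ + k • t) v' = -1 := by simp [he₀v', htv']
  refine ⟨e₀ + k • t, ⟨fun w hw => ?_, fun ρ'' hρ'' hne'' v'' hv'' => ?_⟩, by simp [he₀v, htv]⟩
  · have := ratPairing_toRat (e₀ + k • t) w
    rw [hρ'.toRat_eq hσ hw hv', ratPairing_toRat, hval] at this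
    exact_mod_cast this.symm
  · have hmem : toRat v'' ∈ PointedCone.hull ℚ ((G : Set (RatSpace N)) ∩ ρ'') :=
      mem_hull_inter_of_isFaceOf (hG.symm ▸ hρ''.1) hv''.2
    have hnn : 0 ≤ ratPairing (e₀ + k • t) (toRat v'') := by
      refine nonneg_of_mem_hull (fun g hg => ?_) hmem
      have hgσ := hGσ g hg.1
      suffices h : g ∈ G' by simpa using hk g h
      refine Finset.mem_filter.2 ⟨hg.1, or_iff_not_imp_right.2 fun h0 => ?_⟩
      have hgF : g ∈ F := htF F hF (F.add_mem (hρF hv.2) (hρF' hv'.2)) g hgσ (not_not.1 h0)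
      obtain ⟨a, b, ha, hb, rfl⟩ := exists_smul_add_smul_of_coneDim_eq_two hσ hρ hρ' hne hF hdim
        hρF hρF' hv.2 hx0 hv'.2 hx0' hgF
      rcases hb.eq_or_lt with rfl | hb
      · simp [he₀v]
      · refine absurd (hρ''.eq_of_mem hσ hρ' (hρ''.1.mem_of_smul_add_mem hxσ'
          (PointedCone.smul_mem _ ha hxσ) hb ?_) hv'.2 hx0') hne''
        rw [add_comm]
        exact hg.2
    rw [ratPairing_toRat] at hnn
    exact_mod_cast hnn

end Adjacent

/-! ### Derivations of the coordinate ring, degree by degree -/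

section CoordinateRing

variable {K : Type*} [Field K] {N : Type*} [AddCommGroup N] {σ ρ : PointedCone ℚ (RatSpace N)}

instance [Module.Free ℤ N] [Module.Finite ℤ N] : IsDomain (TorusRing K N) := by
  have : TwoUniqueSums (CharLattice N) :=
    TwoUniqueSums.of_injective_addHom
      (Module.Free.chooseBasis ℤ (CharLattice N)).repr.toAddMonoidHom.toAddHom
      (Module.Free.chooseBasis ℤ (CharLattice N)).repr.injective inferInstance
  exact NoZeroDivisors.to_isDomain _

instance [CharZero K] : CharZero (coordinateRing K σ) :=
  charZero_of_injective_algebraMap (algebraMap K (coordinateRing K σ)).injective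

variable (K) in
/-- The character `χ^m`, `m ∈ σ^∨ ∩ M`, as a regular function on `X`. -/
noncomputable def regularCharacter (m : dualSemigroup σ) : coordinateRing K σ :=
  ⟨character m, single_mem_coordinateRing K m.2 1⟩

@[simp] theorem coe_regularCharacter (m : dualSemigroup σ) :
    (regularCharacter K m : TorusRing K N) = character (m : CharLattice N) := rfl

theorem regularCharacter_add (m n : dualSemigroup σ) :
    regularCharacter K (m + n) = regularCharacter K m * regularCharacter K n := by
  apply Subtype.ext
  simp [character, AddMonoidAlgebra.single_mul_single]

theorem mem_dualSemigroup_of_mem_support (f : coordinateRing K σ) {m : CharLattice N}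
    (h : m ∈ (f : TorusRing K N).coeff.support) : m ∈ dualSemigroup σ :=
  f.2 m h

/-- A submodule of `K[X]` contains `f` if it contains the characters occurring in `f`. -/
theorem mem_of_regularCharacter_mem (L : Submodule K (coordinateRing K σ)) (f : coordinateRing K σ)
    (h : ∀ m : dualSemigroup σ, (f : TorusRing K N).coeff m ≠ 0 → regularCharacter K m ∈ L) :
    f ∈ L := by
  have hf : f = ∑ m ∈ (f : TorusRing K N).coeff.support.attach, (f : TorusRing K N).coeff m.1 •
      regularCharacter K ⟨m.1, mem_dualSemigroup_of_mem_support f m.2⟩ := by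
    apply Subtype.ext
    rw [AddSubmonoidClass.coe_finsetSum]
    refine (AddMonoidAlgebra.sum_coeff_single (f : TorusRing K N)).symm.trans ?_
    rw [Finsupp.sum, ← Finset.sum_attach]
    refine Finset.sum_congr rfl fun m _ => ?_
    rw [Subalgebra.coe_smul, coe_regularCharacter, character, AddMonoidAlgebra.smul_single,
      smul_eq_mul, mul_one]
  rw [hf]
  exact Submodule.sum_mem _ fun m _ => Submodule.smul_mem _ _
    (h ⟨m.1, mem_dualSemigroup_of_mem_support f m.2⟩ (Finsupp.mem_support_iff.1 m.2))

theorem coeff_torusDerivation (v : N) (e k : CharLattice N) (f : TorusRing K N) :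
    (torusDerivation K v e f).coeff (k + e) = ((k v : ℤ) : K) * f.coeff k := by
  classical
  induction f using AddMonoidAlgebra.induction_linear with
  | zero => simp
  | add f g hf hg => simp [hf, hg, mul_add]
  | single m r =>
    have : torusDerivation K v e (AddMonoidAlgebra.single m r) =
        AddMonoidAlgebra.single (m + e) (((m v : ℤ) : K) * r) := torusDerivationAux_single K v e m r
    rw [this, AddMonoidAlgebra.coeff_single, AddMonoidAlgebra.coeff_single, Finsupp.single_apply,
      Finsupp.single_apply]
    by_cases h : m = k
    · simp [h]
    · simp [h]

/-- Translation by `e` is injective on exponents, so the images of distinct characters cannot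
cancel. -/
theorem torusDerivation_eq_zero_iff [CharZero K] (v : N) (e : CharLattice N) (f : TorusRing K N) :
    torusDerivation K v e f = 0 ↔ ∀ m : CharLattice N, f.coeff m ≠ 0 → m v = 0 := by
  constructor
  · intro h m hm
    have := coeff_torusDerivation v e m f
    rw [h, AddMonoidAlgebra.coeff_zero, Finsupp.zero_apply, eq_comm, mul_eq_zero] at this
    exact_mod_cast this.resolve_right hm
  · intro h
    ext k
    have := coeff_torusDerivation v e (k - e) f
    rw [sub_add_cancel] at this
    rw [this, AddMonoidAlgebra.coeff_zero, Finsupp.zero_apply, mul_eq_zero]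
    by_cases hk : f.coeff (k - e) = 0
    · exact Or.inr hk
    · exact Or.inl (by rw [h _ hk, Int.cast_zero])

/-- The coefficient of degree `u` of a derivation of `K[X]`: the coefficient of `χ^{m+u}` in the
image of `χ^m`, which is additive in `m`. -/
noncomputable def degreeCoeff (D : Derivation K (coordinateRing K σ) (coordinateRing K σ))
    (u : CharLattice N) : dualSemigroup σ →+ K where
  toFun m := (D (regularCharacter K m) : TorusRing K N).coeff (m + u)
  map_zero' := by
    have : regularCharacter K (0 : dualSemigroup σ) = 1 := rfl
    rw [this, D.map_one_eq_zero]
    rfl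
  map_add' m n := by
    have h : ∀ (a b : CharLattice N) (f : TorusRing K N),
        (character a * f).coeff (a + b) = f.coeff b := fun a b f => by
      rw [character, AddMonoidAlgebra.coeff_single_mul_apply, one_mul, neg_add_cancel_left]
    rw [regularCharacter_add, D.leibniz]
    simp only [smul_eq_mul, AddMemClass.coe_add, MulMemClass.coe_mul, AddMonoidAlgebra.coeff_add,
      Finsupp.add_apply, coe_regularCharacter]
    rw [add_comm (AddMonoidAlgebra.coeff _ _), show (m + n + u : CharLattice N) = n + (m + u) by abel,
      h, show (n + (m + u) : CharLattice N) = m + (n + u) by abel, h]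

theorem degreeCoeff_apply (D : Derivation K (coordinateRing K σ) (coordinateRing K σ))
    (u : CharLattice N) (m : dualSemigroup σ) :
    degreeCoeff D u m = (D (regularCharacter K m) : TorusRing K N).coeff (m + u) := rfl

theorem add_mem_of_degreeCoeff_ne_zero
    {D : Derivation K (coordinateRing K σ) (coordinateRing K σ)} {u : CharLattice N}
    {m : dualSemigroup σ} (h : degreeCoeff D u m ≠ 0) : (m + u : CharLattice N) ∈ dualSemigroup σ :=
  (D (regularCharacter K m)).2 _ (Finsupp.mem_support_iff.2 h)

/-- If the image of `χ^m` has only the degrees of `σ^∨ ∩ M` relative to `m`, then it is a multiple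
of `χ^m`. -/
theorem regularCharacter_dvd {D : Derivation K (coordinateRing K σ) (coordinateRing K σ)}
    {m : dualSemigroup σ} (h : ∀ u, degreeCoeff D u m ≠ 0 → u ∈ dualSemigroup σ) :
    regularCharacter K m ∣ D (regularCharacter K m) := by
  -- The quotient in the torus ring has the degrees `u` as exponents, so it is regular on `X`.
  refine ⟨⟨character (-m : CharLattice N) * (D (regularCharacter K m) : TorusRing K N),
    fun u hu => h u ?_⟩, Subtype.ext ?_⟩
  · rw [Finsupp.mem_support_iff, character, AddMonoidAlgebra.coeff_single_mul_apply, one_mul,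
      neg_neg] at hu
    exact hu
  · simp [character, ← mul_assoc, AddMonoidAlgebra.single_mul_single, ← AddMonoidAlgebra.one_def]

variable [Module.Free ℤ N] (hfg : σ.FG) (hσ : σ.toConvexCone.Salient)
  (hρ : IsExtremalRay σ ρ) {v : N} (hv : IsPrimitiveVectorOf ρ v) {e : CharLattice N}
  (he : IsDemazureRoot σ ρ e)

theorem demazureDerivation_eq_zero_iff [CharZero K] (f : coordinateRing K σ) :
    demazureDerivation K hfg hσ hρ hv he f = 0 ↔
      ∀ m : CharLattice N, (f : TorusRing K N).coeff m ≠ 0 → m v = 0 := by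
  rw [← torusDerivation_eq_zero_iff v e, ← coe_demazureDerivation K hfg hσ hρ hv he,
    ZeroMemClass.coe_eq_zero]

theorem demazureDerivation_regularCharacter_eq_zero_iff [CharZero K] (m : dualSemigroup σ) :
    demazureDerivation K hfg hσ hρ hv he (regularCharacter K m) = 0 ↔
      (m : CharLattice N) v = 0 := by
  rw [demazureDerivation_eq_zero_iff]
  constructor
  · intro h
    exact h m (by simp [character])
  · intro h k hk
    by_cases hkm : (m : CharLattice N) = k
    · exact hkm ▸ h
    · simp [character, hkm] at hk

/-- Each application lowers the pairing with `v` by one, and a character with zero pairing is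
killed. -/
theorem iterate_demazureDerivation_regularCharacter (m : dualSemigroup σ) (n : ℕ)
    (hn : (m : CharLattice N) v < n) :
    (demazureDerivation K hfg hσ hρ hv he)^[n] (regularCharacter K m) = 0 := by
  induction n generalizing m with
  | zero =>
    have := apply_nonneg_of_mem_dualSemigroup m.2 hρ hv
    push_cast at hn
    omega
  | succ n ih =>
    have h1 : ((demazureDerivation K hfg hσ hρ hv he (regularCharacter K m) : coordinateRing K σ) :
        TorusRing K N) = (((m : CharLattice N) v : ℤ) : K) •
          character ((m : CharLattice N) + e) := by simp
    rw [Function.iterate_succ_apply]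
    by_cases h0 : (m : CharLattice N) v = 0
    · have h2 : demazureDerivation K hfg hσ hρ hv he (regularCharacter K m) = 0 :=
        Subtype.ext (by rw [h1, h0]; simp)
      rw [h2, iterate_map_zero]
    · set m' : dualSemigroup σ := ⟨(m : CharLattice N) + e, he.add_mem hfg hσ hρ hv m.2 h0⟩
      have h2 : demazureDerivation K hfg hσ hρ hv he (regularCharacter K m) =
          (((m : CharLattice N) v : ℤ) : K) • regularCharacter K m' := Subtype.ext h1
      rw [h2, iterate_smul, ih m', smul_zero]
      have := he.pairing_self v hv
      change ((m : CharLattice N) + e) v < n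
      rw [LinearMap.add_apply, this]
      push_cast at hn
      omega

theorem isLND_demazureDerivation : IsLND (demazureDerivation K hfg hσ hρ hv he) := by
  intro f
  refine mem_of_regularCharacter_mem (nilSubmodule (demazureDerivation K hfg hσ hρ hv he)) f
    fun m _ => ?_
  exact ⟨((m : CharLattice N) v).toNat + 1,
    iterate_demazureDerivation_regularCharacter hfg hσ hρ hv he m _ (by omega)⟩

end CoordinateRing

/-! ### Commuting derivations and maximality -/

section Maximality

variable {K : Type*} [Field K] [CharZero K] {N : Type*} [AddCommGroup N] [Module.Free ℤ N]
  [Module.Finite ℤ N] {σ ρ : PointedCone ℚ (RatSpace N)}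
  (hfg : σ.FG) (hσ : σ.toConvexCone.Salient) (hρ : IsExtremalRay σ ρ) {v : N}
  (hv : IsPrimitiveVectorOf ρ v) {e : CharLattice N} (he : IsDemazureRoot σ ρ e)

omit [CharZero K] [Module.Free ℤ N] [Module.Finite ℤ N] in
-- Neither shift changes the pairing used by the other derivation, so both orders multiply
-- coefficients by the same scalars.
theorem torusDerivation_comm {v v' : N} {e e' : CharLattice N} (h : e v' = 0) (h' : e' v = 0)
    (f : TorusRing K N) :
    torusDerivation K v e (torusDerivation K v' e' f) =
      torusDerivation K v' e' (torusDerivation K v e f) := by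
  ext l
  have h1 := coeff_torusDerivation v e (l - e) (torusDerivation K v' e' f)
  have h2 := coeff_torusDerivation v' e' (l - e') (torusDerivation K v e f)
  have h3 := coeff_torusDerivation v' e' (l - e - e') f
  have h4 := coeff_torusDerivation v e (l - e' - e) f
  rw [sub_add_cancel] at h1 h2 h3 h4
  rw [h1, h2, h3, h4, sub_right_comm l e' e]
  simp only [LinearMap.sub_apply, h, h', sub_zero]
  ring

include hfg hσ in
/-- Distinct extremal rays are separated by a character of `X` vanishing on the first. -/
theorem exists_mem_dualSemigroup_apply_ne_zero (hρ : IsExtremalRay σ ρ)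
    (hv : IsPrimitiveVectorOf ρ v) {ρ' : PointedCone ℚ (RatSpace N)} (hρ' : IsExtremalRay σ ρ')
    (hne : ρ' ≠ ρ) {v' : N} (hv' : IsPrimitiveVectorOf ρ' v') :
    ∃ t ∈ dualSemigroup σ, t v = 0 ∧ t v' ≠ 0 ∧ ∀ g ∈ σ, ratPairing t g = 0 → g ∈ ρ := by
  obtain ⟨t, ht, h0, hF⟩ := exists_supporting_character hfg (hρ.1.le hv.2)
  refine ⟨t, ht, by rw [ratPairing_toRat] at h0; exact_mod_cast h0, fun h => hne ?_,
    hF ρ hρ.1 hv.2⟩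
  have h1 : toRat v' ∈ ρ := hF ρ hρ.1 hv.2 _ (hρ'.1.le hv'.2) (by rw [ratPairing_toRat, h]; rfl)
  exact hρ'.eq_of_mem hσ hρ hv'.2 h1 hv'.1.toRat_ne_zero

/-- A derivation commuting with `δ_e` has on `ker δ_e` only degrees in `σ^∨ ∩ M`, provided that `e`
is not orthogonal to any ray adjacent to `ρ`. -/
theorem mem_dualSemigroup_of_degreeCoeff_ne_zero
    (hadj : ∀ ρ' ∈ adjacentRays σ ρ, ∀ v', IsPrimitiveVectorOf ρ' v' → e v' ≠ 0)
    {D : Derivation K (coordinateRing K σ) (coordinateRing K σ)}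
    (hD : ∀ f, demazureDerivation K hfg hσ hρ hv he (D f) =
      D (demazureDerivation K hfg hσ hρ hv he f))
    {m : dualSemigroup σ} (hm : (m : CharLattice N) v = 0) {u : CharLattice N}
    (hu : degreeCoeff D u m ≠ 0) : u ∈ dualSemigroup σ := by
  have huv : u v = 0 := by
    have h1 := hD (regularCharacter K m)
    rw [(demazureDerivation_regularCharacter_eq_zero_iff hfg hσ hρ hv he m).2 hm, map_zero,
      demazureDerivation_eq_zero_iff] at h1
    have := h1 _ hu
    rwa [LinearMap.add_apply, hm, zero_add] at this
  by_contra hus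
  obtain ⟨ρ', hρ', v', hv', huv'⟩ : ∃ ρ' ∈ adjacentRays σ ρ, ∃ v', IsPrimitiveVectorOf ρ' v' ∧
      u v' < 0 := by
    by_contra! h
    exact hus (mem_dualSemigroup_of_adjacentRays hfg hσ hρ hv huv h)
  have hev' : 0 < e v' :=
    lt_of_le_of_ne (he.pairing_nonneg ρ' hρ'.1 hρ'.2.1 v' hv') (hadj ρ' hρ' v' hv').symm
  -- On the facet orthogonal to `v'`, adding `u` leaves the dual cone.
  have hvan : ∀ s : dualSemigroup σ, (s : CharLattice N) v' = 0 → degreeCoeff D u s = 0 := by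
    intro s hs
    by_contra h
    have := apply_nonneg_of_mem_dualSemigroup (add_mem_of_degreeCoeff_ne_zero h) hρ'.1 hv'
    rw [LinearMap.add_apply, hs] at this
    omega
  obtain ⟨t, ht, htv', htv, htρ⟩ := exists_mem_dualSemigroup_apply_ne_zero hfg hσ hρ'.1 hv' hρ
    hρ'.2.1.symm hv
  -- Up to the nonzero scalar `t v`, `δ_e` sends `χ^t` to `χ^n`, so commutation carries the
  -- vanishing at `t` over to `n`, which is off the facet because `n v' = e v' > 0`.
  set n : dualSemigroup σ := ⟨t + e, he.add_mem hfg hσ hρ hv ht htv⟩ with hn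
  have hn0 : degreeCoeff D u n = 0 := by
    have h1 : demazureDerivation K hfg hσ hρ hv he (regularCharacter K ⟨t, ht⟩) =
        ((t v : ℤ) : K) • regularCharacter K n := Subtype.ext (by simp [hn])
    have h2 := congrArg (fun f : coordinateRing K σ => (f : TorusRing K N).coeff (t + u + e))
      (hD (regularCharacter K ⟨t, ht⟩))
    simp only [h1, Derivation.map_smul, coe_demazureDerivation, coeff_torusDerivation] at h2
    have h3 : (D (regularCharacter K ⟨t, ht⟩) : TorusRing K N).coeff (t + u) = 0 :=
      hvan ⟨t, ht⟩ htv'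
    have h4 : (D (regularCharacter K n) : TorusRing K N).coeff (t + u + e) =
        degreeCoeff D u n := by
      rw [degreeCoeff_apply, hn, add_right_comm]
    rw [h3, mul_zero, Subalgebra.coe_smul, AddMonoidAlgebra.coeff_smul_apply, h4, smul_eq_mul,
      eq_comm, mul_eq_zero] at h2
    exact h2.resolve_left (by exact_mod_cast htv)
  obtain ⟨a, ha⟩ := Int.eq_ofNat_of_zero_le hev'.le
  obtain ⟨b, hb⟩ := Int.eq_ofNat_of_zero_le (apply_nonneg_of_mem_dualSemigroup m.2 hρ'.1 hv')
  -- With `a = n v'` and `b = m v'` this is orthogonal to `v'`, and a multiple of `t` brings it into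
  -- the dual cone. Additivity then reduces `a • m` to elements where the coefficient vanishes.
  set m₀ : CharLattice N := a • (m : CharLattice N) - b • (n : CharLattice N) with hm₀
  have hm₀v' : m₀ v' = 0 := by
    simp only [hm₀, hn, LinearMap.sub_apply, LinearMap.smul_apply, LinearMap.add_apply, ha, hb, htv',
      nsmul_eq_mul]
    ring
  obtain ⟨k, hk⟩ := exists_add_nsmul_mem_dualSemigroup hfg ht m₀ fun g hg h0 => by
    obtain ⟨c, -, rfl⟩ := hρ'.1.exists_smul hσ hv'.2 hv'.1.toRat_ne_zero (htρ g hg h0)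
    rw [map_smul, ratPairing_toRat, hm₀v']
    simp
  have hsum : (⟨m₀ + k • t, hk⟩ : dualSemigroup σ) + b • n = a • m + k • ⟨t, ht⟩ :=
    Subtype.ext (by simp only [hm₀, AddMemClass.coe_add, AddSubmonoidClass.coe_nsmul]; abel)
  have hα := congrArg (degreeCoeff D u) hsum
  rw [map_add, map_add, map_nsmul, map_nsmul, map_nsmul, hn0, hvan ⟨t, ht⟩ htv',
    hvan ⟨m₀ + k • t, hk⟩ (by simp [hm₀v', htv']), smul_zero, smul_zero, add_zero, add_zero,
    nsmul_eq_mul, eq_comm, mul_eq_zero] at hα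
  have ha0 : (a : K) ≠ 0 := by
    have : a ≠ 0 := by rintro rfl; simp [ha] at hev'
    exact_mod_cast this
  exact hu (hα.resolve_left ha0)

theorem isMaximalLND_demazureDerivation
    (hadj : ∀ ρ' ∈ adjacentRays σ ρ, ∀ v', IsPrimitiveVectorOf ρ' v' → e v' ≠ 0) :
    IsMaximalLND (demazureDerivation K hfg hσ hρ hv he) := by
  refine ⟨isLND_demazureDerivation hfg hσ hρ hv he, fun D hD hD0 hcomm => ?_⟩
  refine (isLND_demazureDerivation hfg hσ hρ hv he).areEquivalent_of_commute hD0 hcomm fun f hf => ?_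
  have hc : ∀ f, demazureDerivation K hfg hσ hρ hv he (D f) =
      D (demazureDerivation K hfg hσ hρ hv he f) := fun f => by
    have := congrArg (fun E : Derivation K _ _ => E f) hcomm
    rw [Derivation.commutator_apply] at this
    exact sub_eq_zero.1 this
  refine mem_of_regularCharacter_mem (LinearMap.ker (D : _ →ₗ[K] coordinateRing K σ)) f
    fun m hm => ?_
  have hmv := (demazureDerivation_eq_zero_iff hfg hσ hρ hv he f).1 hf m hm
  exact hD.apply_eq_zero_of_dvd (regularCharacter_dvd fun u hu =>
    mem_dualSemigroup_of_degreeCoeff_ne_zero hfg hσ hρ hv he hadj hc hmv hu)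

theorem apply_ne_zero_of_isMaximalLND
    (hmax : IsMaximalLND (demazureDerivation K hfg hσ hρ hv he))
    {ρ' : PointedCone ℚ (RatSpace N)} (hρ' : ρ' ∈ adjacentRays σ ρ) {v' : N}
    (hv' : IsPrimitiveVectorOf ρ' v') : e v' ≠ 0 := by
  intro hev'
  obtain ⟨e', he', he'v⟩ := he.exists_adjacent_root hfg hσ hρ hv hρ' hv' hev'
  obtain ⟨t, ht, htv, htv', -⟩ := exists_mem_dualSemigroup_apply_ne_zero hfg hσ hρ hv hρ'.1
    hρ'.2.1 hv'
  have hne : demazureDerivation K hfg hσ hρ'.1 hv' he' (regularCharacter K ⟨t, ht⟩) ≠ 0 := fun h =>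
    htv' ((demazureDerivation_regularCharacter_eq_zero_iff hfg hσ hρ'.1 hv' he' ⟨t, ht⟩).1 h)
  have heq := hmax.2 (demazureDerivation K hfg hσ hρ'.1 hv' he')
    (isLND_demazureDerivation hfg hσ hρ'.1 hv' he')
    (fun h => hne (by rw [h, Derivation.zero_apply])) (by
      refine Derivation.ext fun f => ?_
      rw [Derivation.commutator_apply]
      rw [Derivation.zero_apply, sub_eq_zero, ← Subtype.coe_inj]
      simp only [coe_demazureDerivation]
      exact torusDerivation_comm hev' he'v _)
  have hmem : regularCharacter K ⟨t, ht⟩ ∈ LinearMap.ker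
      (demazureDerivation K hfg hσ hρ hv he : coordinateRing K σ →ₗ[K] coordinateRing K σ) :=
    (demazureDerivation_regularCharacter_eq_zero_iff hfg hσ hρ hv he ⟨t, ht⟩).2 htv
  rw [heq] at hmem
  exact hne hmem

end Maximality

end AffineToric

theorem mainTheorem4 {K : Type*} [Field K] [IsAlgClosed K] [CharZero K]
    {N : Type*} [AddCommGroup N] [Module.Free ℤ N] [Module.Finite ℤ N]
    (σ : PointedCone ℚ (AffineToric.RatSpace N)) (hfg : σ.FG) (hσ : σ.toConvexCone.Salient)
    (ρ : PointedCone ℚ (AffineToric.RatSpace N)) (hρ : AffineToric.IsExtremalRay σ ρ)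
    (v : N) (hv : AffineToric.IsPrimitiveVectorOf ρ v)
    (e : AffineToric.CharLattice N) (he : AffineToric.IsDemazureRoot σ ρ e) :
    AffineToric.IsMaximalLND (AffineToric.demazureDerivation K hfg hσ hρ hv he) ↔
      ∀ ρ' ∈ AffineToric.adjacentRays σ ρ, ∀ v' : N, AffineToric.IsPrimitiveVectorOf ρ' v' →
        e v' ≠ 0 :=
  ⟨fun hmax _ hρ' _ hv' =>
    AffineToric.apply_ne_zero_of_isMaximalLND hfg hσ hρ hv he hmax hρ' hv',
  AffineToric.isMaximalLND_demazureDerivation hfg hσ hρ hv he⟩
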